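/- Let $\mathbb{H}^N$ denote the $N$-dimensional hyperbolic space (curvature $-1$) with geodesic distance $\mathrm{d}(\cdot,\cdot)$, Riemannian gradient $\nabla_{\mathbb{H}^N}$ and Riemannian volume $\mathrm{d}v_{\mathbb{H}^N}$, and let $g(r)=\dfrac{r\coth r-1}{r^2}$ for $r>0$. Let $N\ge 3$ and $M\ge 2$ be integers. The equation $$\frac{\pi^2}{\bar d^{\,2}}+(M+1)\left(\frac{(N-2)^2}{4}\,\frac{1}{\bar d^{\,2}}+\frac{(N-3)(N-2)}{2}\,g(\bar d/2)\right)=N-2$$ has exactly one solution $\bar d=\bar d(M,N)>0$. Let $y_1,\dots,y_M\in\mathbb{H}^N$ and put $d:=\min_{1\le j\ne k\le M}\dfrac{\mathrm{d}(y_j,y_k)}{2}$. If $d\ge\bar d$, then for all $u\in C_c^\infty(\mathbb{H}^N)$ all the integrals below are finite and $$\int_{\mathbb{H}^N}|\nabla_{\mathbb{H}^N}u|^2\,\mathrm{d}v_{\mathbb{H}^N}\ \ge\ \frac{(N-2)^2}{4}\sum_{k=1}^M\int_{\mathbb{H}^N}\frac{u^2}{\mathrm{d}^2(x,y_k)}\,\mathrm{d}v_{\mathbb{H}^N}+\frac{(N-2)(N-3)}{2}\sum_{k=1}^M\int_{\mathbb{H}^N}g(\mathrm{d}(x,y_k))\,u^2\,\mathrm{d}v_{\mathbb{H}^N}.$$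 -/

import Mathlib

open scoped ContDiff

noncomputable section

namespace MultipolarHardy

/-- The underlying set of hyperbolic space `ℍ^N` in the Poincaré ball model: the open unit ball of
`ℝ^N`. The Riemannian metric is `(2 / (1 - |x|²))² |dx|²`, of constant curvature `-1`. -/
def hypSpace (N : ℕ) : Set (EuclideanSpace ℝ (Fin N)) :=
  Metric.ball 0 1

/-- The conformal factor `2 / (1 - |x|²)` of the Poincaré metric. -/
def conf {N : ℕ} (x : EuclideanSpace ℝ (Fin N)) : ℝ :=
  2 / (1 - ‖x‖ ^ 2)

/-- The Poincaré metric at `x`: `g_x(v, w) = (2 / (1 - |x|²))² ⟨v, w⟩`. -/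
def hypMetric {N : ℕ} (x v w : EuclideanSpace ℝ (Fin N)) : ℝ :=
  conf x ^ 2 * inner ℝ v w

/-- The Riemannian gradient of `u` for the Poincaré metric: in coordinates `g^{ij} ∂_i u`. -/
def hypGrad {N : ℕ} (u : EuclideanSpace ℝ (Fin N) → ℝ) (x : EuclideanSpace ℝ (Fin N)) :
    EuclideanSpace ℝ (Fin N) :=
  (conf x ^ 2)⁻¹ • gradient u x

/-- `|∇u|²`, the squared length of the Riemannian gradient measured in the Poincaré metric. -/
def hypGradSq {N : ℕ} (u : EuclideanSpace ℝ (Fin N) → ℝ) (x : EuclideanSpace ℝ (Fin N)) : ℝ :=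
  hypMetric x (hypGrad u x) (hypGrad u x)

/-- The Riemannian volume of `ℍ^N`: `dv = √(det g) dx = (2 / (1 - |x|²))^N dx` on the unit ball. -/
def hypVolume (N : ℕ) : MeasureTheory.Measure (EuclideanSpace ℝ (Fin N)) :=
  (MeasureTheory.volume.restrict (hypSpace N)).withDensity
    (fun x => ENNReal.ofReal (conf x ^ N))

/-- The geodesic distance of the Poincaré ball:
`cosh d(x, y) = 1 + 2 |x - y|² / ((1 - |x|²) (1 - |y|²))`. -/
def hypDist {N : ℕ} (x y : EuclideanSpace ℝ (Fin N)) : ℝ :=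
  Real.arcosh (1 + 2 * ‖x - y‖ ^ 2 / ((1 - ‖x‖ ^ 2) * (1 - ‖y‖ ^ 2)))

/-- `C_c^∞(ℍ^N)`: smooth functions with compact support inside the open unit ball
(identified with their extension by zero to `ℝ^N`). -/
def IsTestFunction {N : ℕ} (u : EuclideanSpace ℝ (Fin N) → ℝ) : Prop :=
  ContDiff ℝ ∞ u ∧ HasCompactSupport u ∧ tsupport u ⊆ hypSpace N

/-- `g(r) = (r coth r - 1) / r²` for `r > 0`. -/
def gFun (r : ℝ) : ℝ :=
  (r * (Real.cosh r / Real.sinh r) - 1) / r ^ 2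

/-- Half of the minimal distance between two poles with different indices
(a minimum over a finite set, nonempty as soon as there are at least two poles). -/
def halfMinDist {N M : ℕ} (y : Fin M → EuclideanSpace ℝ (Fin N)) : ℝ :=
  ⨅ p : {p : Fin M × Fin M // p.1 ≠ p.2}, hypDist (y p.1.1) (y p.1.2) / 2

/-- `r` is a positive solution of the equation that defines the threshold `d̄(M, N)`:
`π²/r² + (M+1) ((N-2)²/4 · 1/r² + (N-3)(N-2)/2 · g(r/2)) = N - 2`. -/
def IsThreshold (M N : ℕ) (r : ℝ) : Prop :=
  0 < r ∧
    Real.pi ^ 2 / r ^ 2 +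
      ((M : ℝ) + 1) * (((N : ℝ) - 2) ^ 2 / 4 * (1 / r ^ 2) +
        ((N : ℝ) - 3) * ((N : ℝ) - 2) / 2 * gFun (r / 2)) = (N : ℝ) - 2

end MultipolarHardy

end

noncomputable section

namespace MultipolarHardy

open Set Filter Topology MeasureTheory

/-! The proof is the vector field method. For a C¹ field `G`, expanding `|∇u + uG|² ≥ 0` and
integrating by parts gives `∫ (div G - |G|²) u² ≤ ∫ |∇u|²` (`integral_sq_mul_fieldDensity_le`), so
it is enough to find `G` with `div G - |G|²` at least the sum of the Hardy potentials.

Around one pole, `H = h(r) ∇r` with `h = hardyField` gives exactly the potential plus a reserve `N -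
2` (`hardyField_riccati`). The background field `B = (N-2) ∇cosh d(·,0) / (1 + cosh d(·,0))` gives
`N - 2 + (N-2)² / (1 + cosh d(·,0))`. Around each pole they are glued into `qH + (1-q)B`, where `q =
cos² φ(r)` is `1` for `r ≤ d̄/2` and `0` for `r ≥ d̄`; the poles are `2d̄` apart, so at most one
cutoff is active at a point. Gluing adds `q(1-q)|H-B|² + ⟨∇q, H-B⟩`, which is at least
`-q'²/(4q(1-q)) = -φ'²` where `0 < q < 1`. Since `φ` climbs `π/2` over a length `d̄/2`, the cost is
`π²/d̄²`.

The reserve pays for this and for the potentials not yet covered. With `U` the bracket in the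
threshold equation, each of the other `M - 1` poles costs at most `U`, and the share `1 - q` of the
near pole at most `2U`. Hence `π²/d̄² + (M+1)U = N - 2` is exactly what is needed
(`fieldDensity_coeffs_bounds`).

As `H` is singular at its pole, it is truncated there by a nondecreasing factor, which keeps the
density nonnegative; Fatou's lemma removes the truncation (`lintegral_sq_mul_hardyPot_le`). -/

/-! ### Hyperbolic inequalities, the function `g` and the threshold -/

theorem lt_sinh_of_pos {r : ℝ} (hr : 0 < r) : r < Real.sinh r := Real.self_lt_sinh_iff.2 hr

theorem sinh_lt_mul_cosh {r : ℝ} (hr : 0 < r) : Real.sinh r < r * Real.cosh r := by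
  have hd : ∀ t : ℝ, HasDerivAt (fun t => t * Real.cosh t - Real.sinh t) (t * Real.sinh t) t := by
    intro t
    refine (((hasDerivAt_id t).mul (Real.hasDerivAt_cosh t)).sub
      (Real.hasDerivAt_sinh t)).congr_deriv ?_
    simp
  have hm : StrictMonoOn (fun t => t * Real.cosh t - Real.sinh t) (Ici 0) := by
    apply strictMonoOn_of_deriv_pos (convex_Ici 0)
    · exact fun t _ => (hd t).continuousAt.continuousWithinAt
    · intro t ht
      rw [interior_Ici] at ht
      rw [(hd t).deriv]
      exact mul_pos ht (Real.sinh_pos_iff.2 ht)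
  have := hm (mem_Ici.2 le_rfl) (mem_Ici.2 hr.le) hr
  simp at this
  linarith

/-- A function vanishing at `0` with nonnegative derivative on `(0, ∞)` is nonnegative there. -/
theorem nonneg_of_hasDerivAt {f f' : ℝ → ℝ} (hf : ∀ t, HasDerivAt f (f' t) t) (h0 : f 0 = 0)
    (hf' : ∀ t, 0 < t → 0 ≤ f' t) {t : ℝ} (ht : 0 < t) : 0 ≤ f t := by
  have hm : MonotoneOn f (Ici 0) := by
    apply monotoneOn_of_deriv_nonneg (convex_Ici 0)
    · exact fun t _ => (hf t).continuousAt.continuousWithinAt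
    · exact fun t _ => (hf t).differentiableAt.differentiableWithinAt
    · intro t ht
      rw [interior_Ici] at ht
      rw [(hf t).deriv]
      exact hf' t ht
  have := hm (mem_Ici.2 le_rfl) (mem_Ici.2 ht.le) ht.le
  rwa [h0] at this

/-- Three differentiations reduce this to `t cosh t - sinh t > 0`, every intermediate function
vanishing at `0`. At `t = 2r` it is the sign condition for `g'`. -/
theorem four_mul_cosh_sub_le {t : ℝ} (ht : 0 < t) :
    4 * Real.cosh t - 4 ≤ t * Real.sinh t + t ^ 2 := by
  have h1 : ∀ t : ℝ, 0 < t → 0 ≤ t * Real.sinh t + 2 - 2 * Real.cosh t := by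
    intro t ht
    refine nonneg_of_hasDerivAt (f := fun t => t * Real.sinh t + 2 - 2 * Real.cosh t)
      (f' := fun t => t * Real.cosh t - Real.sinh t) (fun t => ?_) (by simp) (fun t ht => ?_) ht
    · refine ((((hasDerivAt_id t).mul (Real.hasDerivAt_sinh t)).add_const 2).sub
        ((Real.hasDerivAt_cosh t).const_mul 2)).congr_deriv ?_
      simp; ring
    · linarith [sinh_lt_mul_cosh ht]
  have h2 : ∀ t : ℝ, 0 < t → 0 ≤ t * Real.cosh t + 2 * t - 3 * Real.sinh t := by
    intro t ht
    refine nonneg_of_hasDerivAt (f := fun t => t * Real.cosh t + 2 * t - 3 * Real.sinh t)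
      (f' := fun t => t * Real.sinh t + 2 - 2 * Real.cosh t) (fun t => ?_) (by simp) h1 ht
    refine ((((hasDerivAt_id t).mul (Real.hasDerivAt_cosh t)).add
      ((hasDerivAt_id t).const_mul 2)).sub ((Real.hasDerivAt_sinh t).const_mul 3)).congr_deriv ?_
    simp; ring
  have h3 := nonneg_of_hasDerivAt
      (f := fun t => t * Real.sinh t + t ^ 2 - (4 * Real.cosh t - 4))
      (f' := fun t => t * Real.cosh t + 2 * t - 3 * Real.sinh t) (fun t => ?_) (by simp) h2 ht
  · simpa using h3
  · refine ((((hasDerivAt_id t).mul (Real.hasDerivAt_sinh t)).add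
      ((hasDerivAt_id t).pow 2)).sub (((Real.hasDerivAt_cosh t).const_mul 4).sub_const
      4)).congr_deriv ?_
    simp; ring

theorem gFun_nonneg {r : ℝ} (hr : 0 < r) : 0 ≤ gFun r := by
  have hs := Real.sinh_pos_iff.2 hr
  have : 1 ≤ r * (Real.cosh r / Real.sinh r) := by
    rw [← mul_div_assoc, le_div_iff₀ hs]
    linarith [sinh_lt_mul_cosh hr]
  exact div_nonneg (by linarith) (by positivity)

/-- Equivalent to `coth r ≤ 1 + 1/r`, which follows from `cosh r - sinh r = exp (-r) ≤ 1` and `r <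
sinh r`. It gives the decay at infinity and, later, the integrability of the `g` terms. -/
theorem gFun_le_inv {r : ℝ} (hr : 0 < r) : gFun r ≤ 1 / r := by
  have hs := Real.sinh_pos_iff.2 hr
  have h1 : r * (Real.cosh r / Real.sinh r) - 1 ≤ r := by
    have h2 : r * (Real.cosh r - Real.sinh r) ≤ Real.sinh r := by
      rw [Real.cosh_sub_sinh]
      have := lt_sinh_of_pos hr
      have h3 : Real.exp (-r) ≤ 1 := Real.exp_le_one_iff.2 (by linarith)
      nlinarith
    rw [← mul_div_assoc, sub_le_iff_le_add, div_le_iff₀ hs]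
    linarith
  rw [gFun, div_le_div_iff₀ (by positivity) hr]
  nlinarith

theorem hasDerivAt_cosh_div_sinh {r : ℝ} (hr : 0 < r) :
    HasDerivAt (fun t => Real.cosh t / Real.sinh t) (-1 / Real.sinh r ^ 2) r := by
  have hs := Real.sinh_pos_iff.2 hr
  refine ((Real.hasDerivAt_cosh r).div (Real.hasDerivAt_sinh r) hs.ne').congr_deriv ?_
  rw [← Real.cosh_sq_sub_sinh_sq r]
  ring

theorem hasDerivAt_gFun {r : ℝ} (hr : 0 < r) :
    HasDerivAt gFun ((2 - r * (Real.cosh r / Real.sinh r) - r ^ 2 / Real.sinh r ^ 2) / r ^ 3) r := by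
  have hs := Real.sinh_pos_iff.2 hr
  refine ((((hasDerivAt_id r).mul (hasDerivAt_cosh_div_sinh hr)).sub_const 1).div
    ((hasDerivAt_id r).pow 2) (by simpa using hr.ne')).congr_deriv ?_
  simp
  field_simp
  ring

theorem continuousOn_gFun : ContinuousOn gFun (Ioi 0) :=
  fun _ hr => (hasDerivAt_gFun hr).continuousAt.continuousWithinAt

theorem antitoneOn_gFun : AntitoneOn gFun (Ioi 0) := by
  apply antitoneOn_of_deriv_nonpos (convex_Ioi 0) continuousOn_gFun
  · rw [interior_Ioi]
    exact fun t ht => (hasDerivAt_gFun ht).differentiableAt.differentiableWithinAt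
  · intro r hr
    rw [interior_Ioi, mem_Ioi] at hr
    rw [(hasDerivAt_gFun hr).deriv]
    have hs := Real.sinh_pos_iff.2 hr
    apply div_nonpos_of_nonpos_of_nonneg _ (by positivity)
    have h := four_mul_cosh_sub_le (t := 2 * r) (by linarith)
    rw [Real.cosh_two_mul, Real.sinh_two_mul, Real.cosh_sq] at h
    have : 2 - r * (Real.cosh r / Real.sinh r) - r ^ 2 / Real.sinh r ^ 2 =
      (2 * Real.sinh r ^ 2 - r * Real.cosh r * Real.sinh r - r ^ 2) / Real.sinh r ^ 2 := by
      field_simp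
    rw [this]
    apply div_nonpos_of_nonpos_of_nonneg _ (by positivity)
    nlinarith

/-- The left side is continuous and, thanks to the `π²/r²` term, strictly decreasing; it passes `N -
2` between small and large `r`. -/
theorem existsUnique_isThreshold (N M : ℕ) (hN : 3 ≤ N) : ∃! r : ℝ, IsThreshold M N r := by
  have hn : (3 : ℝ) ≤ N := by exact_mod_cast hN
  set n : ℝ := (N : ℝ)
  set c : ℝ := (M : ℝ) + 1
  have hc : 0 < c := by positivity
  set F : ℝ → ℝ := fun r => Real.pi ^ 2 / r ^ 2 + c * ((n - 2) ^ 2 / 4 * (1 / r ^ 2) +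
        (n - 3) * (n - 2) / 2 * gFun (r / 2)) with hF
  have hk : 0 ≤ (n - 3) * (n - 2) / 2 := by
    have := mul_nonneg (by linarith : 0 ≤ n - 3) (by linarith : 0 ≤ n - 2); linarith
  have hpi := Real.pi_pos
  have hanti : StrictAntiOn F (Ioi 0) := by
    intro r hr s hs hrs
    rw [mem_Ioi] at hr hs
    have h1 : 1 / s ^ 2 < 1 / r ^ 2 := by gcongr
    have h2 : gFun (s / 2) ≤ gFun (r / 2) :=
      antitoneOn_gFun (by simpa using hr) (by simpa using hs) (by linarith)
    have h3 : Real.pi ^ 2 / s ^ 2 < Real.pi ^ 2 / r ^ 2 := by gcongr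
    have : (n - 2) ^ 2 / 4 * (1 / s ^ 2) + (n - 3) * (n - 2) / 2 * gFun (s / 2) ≤
        (n - 2) ^ 2 / 4 * (1 / r ^ 2) + (n - 3) * (n - 2) / 2 * gFun (r / 2) := by gcongr
    exact add_lt_add_of_lt_of_le h3 (mul_le_mul_of_nonneg_left this hc.le)
  have hcont : ContinuousOn F (Ioi 0) := by
    have hg : ContinuousOn (fun r : ℝ => gFun (r / 2)) (Ioi 0) :=
      continuousOn_gFun.comp (by fun_prop) (fun r hr => by simpa using hr)
    have h2 : ∀ r ∈ Ioi (0 : ℝ), r ^ 2 ≠ 0 := fun r hr => pow_ne_zero _ (ne_of_gt hr)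
    apply ContinuousOn.add
    · exact continuousOn_const.div (by fun_prop) h2
    · apply ContinuousOn.mul continuousOn_const
      apply ContinuousOn.add
      · exact continuousOn_const.mul (continuousOn_const.div (by fun_prop) h2)
      · exact continuousOn_const.mul hg
  have hlow : ∃ r > 0, n - 2 ≤ F r := by
    -- At this radius the first term alone is `π² (n-2)² ≥ n - 2`.
    refine ⟨1 / (n - 2), by have : 0 < n - 2 := by linarith
                            positivity, ?_⟩
    have hr : 0 < 1 / (n - 2) / 2 := by have : 0 < n - 2 := by linarith
                                        positivity
    have hg := gFun_nonneg hr
    have h1 : Real.pi ^ 2 / (1 / (n - 2)) ^ 2 = Real.pi ^ 2 * (n - 2) ^ 2 := by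
      rw [one_div, inv_pow, div_inv_eq_mul]
    have h3 : 1 ≤ Real.pi ^ 2 := by nlinarith [Real.pi_gt_three]
    have h4 : n - 2 ≤ Real.pi ^ 2 * (n - 2) ^ 2 := by nlinarith
    rw [hF]
    simp only [h1]
    have : 0 ≤ c * ((n - 2) ^ 2 / 4 * (1 / (1 / (n - 2)) ^ 2) +
        (n - 3) * (n - 2) / 2 * gFun (1 / (n - 2) / 2)) := by positivity
    linarith
  have hhigh : ∀ s > 0, ∃ r ≥ s, F r ≤ n - 2 := by
    intro s hs
    -- For `r ≥ 1` every term is at most a constant times `1/r`; `K` is the total constant, so `r ≥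
    -- K/(n-2)` suffices.
    set K := Real.pi ^ 2 + c * ((n - 2) ^ 2 / 4 + (n - 3) * (n - 2) / 2 * 2) with hK
    have hK0 : 0 < K := by positivity
    set r := max s (max 1 (K / (n - 2)))
    have hr1 : 1 ≤ r := le_max_of_le_right (le_max_left _ _)
    have hrK : K / (n - 2) ≤ r := le_max_of_le_right (le_max_right _ _)
    refine ⟨r, le_max_left _ _, ?_⟩
    have hr0 : 0 < r := by linarith
    have h1 : 1 / r ^ 2 ≤ 1 / r := by
      apply one_div_le_one_div_of_le hr0; nlinarith
    have h2 : gFun (r / 2) ≤ 2 * (1 / r) := by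
      refine (gFun_le_inv (by linarith)).trans (le_of_eq ?_)
      field_simp
    have h3 : Real.pi ^ 2 / r ^ 2 ≤ Real.pi ^ 2 * (1 / r) := by
      rw [div_eq_mul_one_div]; gcongr
    have h4 : F r ≤ K * (1 / r) := by
      have : c * ((n - 2) ^ 2 / 4 * (1 / r ^ 2) + (n - 3) * (n - 2) / 2 * gFun (r / 2)) ≤
        c * ((n - 2) ^ 2 / 4 * (1 / r) + (n - 3) * (n - 2) / 2 * (2 * (1 / r))) := by gcongr
      calc F r ≤ Real.pi ^ 2 * (1 / r) +
          c * ((n - 2) ^ 2 / 4 * (1 / r) + (n - 3) * (n - 2) / 2 * (2 * (1 / r))) :=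
            add_le_add h3 this
        _ = K * (1 / r) := by rw [hK]; ring
    refine h4.trans ?_
    rw [mul_one_div, div_le_iff₀ hr0]
    rwa [div_le_iff₀' (by linarith)] at hrK
  obtain ⟨r₁, hr₁, h₁⟩ := hlow
  obtain ⟨r₂, hr₂, h₂⟩ := hhigh r₁ hr₁
  have hsub : Icc r₁ r₂ ⊆ Ioi 0 := fun t ht => lt_of_lt_of_le hr₁ ht.1
  obtain ⟨r, hr, hFr⟩ := intermediate_value_Icc' hr₂ (hcont.mono hsub) ⟨h₂, h₁⟩
  exact ⟨r, ⟨hsub hr, hFr⟩, fun s hs => hanti.injOn hs.1 (hsub hr) (hs.2.trans hFr.symm)⟩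

/-! ### The radial Hardy field of one pole -/

/-- The Hardy potential `(n-2)²/4 · r⁻² + (n-2)(n-3)/2 · g(r)` of one pole. -/
def hardyPot (n r : ℝ) : ℝ :=
  (n - 2) ^ 2 / 4 * (1 / r ^ 2) + (n - 2) * (n - 3) / 2 * gFun r

theorem hardyPot_nonneg {n r : ℝ} (hn : 3 ≤ n) (hr : 0 < r) : 0 ≤ hardyPot n r := by
  have := gFun_nonneg hr
  have h2 : 0 ≤ n - 2 := by linarith
  have h3 : 0 ≤ n - 3 := by linarith
  unfold hardyPot
  positivity

theorem hardyPot_le {n r s : ℝ} (hn : 3 ≤ n) (hr : 0 < r) (hrs : r ≤ s) :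
    hardyPot n s ≤ hardyPot n r := by
  have := antitoneOn_gFun (mem_Ioi.2 hr) (mem_Ioi.2 (hr.trans_le hrs)) hrs
  have h2 : 0 ≤ n - 2 := by linarith
  have h3 : 0 ≤ n - 3 := by linarith
  unfold hardyPot
  gcongr

/-- The radial component of `-∇ log φ` for the ground state `φ(r) = r^((n-2)/2) / sinh^(n-2) r`. -/
def hardyField (n r : ℝ) : ℝ :=
  (n - 2) * (Real.cosh r / Real.sinh r) - (n - 2) / 2 * r⁻¹

theorem hardyField_nonneg {n r : ℝ} (hn : 3 ≤ n) (hr : 0 < r) : 0 ≤ hardyField n r := by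
  have hs := Real.sinh_pos_iff.2 hr
  have h : r⁻¹ ≤ Real.cosh r / Real.sinh r := by
    rw [inv_le_iff_one_le_mul₀ hr, div_mul_eq_mul_div, le_div_iff₀ hs]
    linarith [sinh_lt_mul_cosh hr]
  have h0 : 0 < r⁻¹ := by positivity
  unfold hardyField
  nlinarith

theorem hasDerivAt_hardyField (n : ℝ) {r : ℝ} (hr : 0 < r) :
    HasDerivAt (hardyField n) (-(n - 2) / Real.sinh r ^ 2 + (n - 2) / 2 / r ^ 2) r := by
  refine (((hasDerivAt_cosh_div_sinh hr).const_mul (n - 2)).sub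
    ((hasDerivAt_inv hr.ne').const_mul ((n - 2) / 2))).congr_deriv ?_
  ring

/-- With `h = -φ'/φ`, the left side is `-Δφ/φ` for the ground state `φ`. The surplus `n - 2` on the
right is the reserve that pays for the localisation and the other poles. -/
theorem hardyField_riccati (n : ℝ) {r : ℝ} (hr : 0 < r) :
    (-(n - 2) / Real.sinh r ^ 2 + (n - 2) / 2 / r ^ 2) +
      (n - 1) * (Real.cosh r / Real.sinh r) * hardyField n r - hardyField n r ^ 2 =
    hardyPot n r + (n - 2) := by
  have hs := Real.sinh_pos_iff.2 hr
  have h := Real.cosh_sq r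
  unfold hardyPot hardyField gFun
  field_simp
  ring_nf
  simp only [h]
  ring

theorem contDiffAt_hardyField (n : ℝ) {r : ℝ} (hr : 0 < r) :
    ContDiffAt ℝ 1 (hardyField n) r := by
  have hs := (Real.sinh_pos_iff.2 hr).ne'
  unfold hardyField
  exact (contDiffAt_const.mul (Real.contDiff_cosh.contDiffAt.div
    Real.contDiff_sinh.contDiffAt hs)).sub (contDiffAt_const.mul (contDiffAt_inv ℝ hr.ne'))

/-! ### Outer and inner cutoffs -/

/-- Truncation of `t` to `[0, π/2]`. -/
def clampAngle (t : ℝ) : ℝ := max 0 (min t (Real.pi / 2))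

theorem continuous_clampAngle : Continuous clampAngle := by
  unfold clampAngle; fun_prop

theorem clampAngle_of_nonpos {t : ℝ} (ht : t ≤ 0) : clampAngle t = 0 :=
  max_eq_left ((min_le_left _ _).trans ht)

theorem clampAngle_of_ge {t : ℝ} (ht : Real.pi / 2 ≤ t) : clampAngle t = Real.pi / 2 := by
  rw [clampAngle, min_eq_right ht, max_eq_right (by positivity)]

theorem clampAngle_of_mem {t : ℝ} (h0 : 0 ≤ t) (ht : t ≤ Real.pi / 2) : clampAngle t = t := by
  rw [clampAngle, min_eq_left ht, max_eq_right h0]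

/-- The clamp has corners at `0` and `π/2`, but the derivative `-2 sin cos` of `cos²` vanishes at
both, so the one-sided derivatives agree there. This makes the cutoff C¹ while its angle is only
Lipschitz. -/
theorem hasDerivAt_cos_sq_clampAngle (t : ℝ) :
    HasDerivAt (fun t => Real.cos (clampAngle t) ^ 2)
      (-2 * Real.sin (clampAngle t) * Real.cos (clampAngle t)) t := by
  have hpi := Real.pi_div_two_pos
  have hcos : ∀ t : ℝ, HasDerivAt (fun t => Real.cos t ^ 2) (-2 * Real.sin t * Real.cos t) t := by
    intro t
    refine ((Real.hasDerivAt_cos t).pow 2).congr_deriv ?_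
    simp; ring
  rcases lt_trichotomy t 0 with h | h | h
  · rw [clampAngle_of_nonpos h.le]
    refine ((hasDerivAt_const t (1 : ℝ)).congr_of_eventuallyEq ?_).congr_deriv (by simp)
    filter_upwards [Iio_mem_nhds h] with s hs
    simp [clampAngle_of_nonpos (le_of_lt hs)]
  · subst h
    rw [clampAngle_of_nonpos le_rfl, ← hasDerivWithinAt_univ, ← Iic_union_Ici (a := (0 : ℝ))]
    apply HasDerivWithinAt.union
    · refine ((hasDerivWithinAt_const 0 (Iic 0) (1 : ℝ)).congr (fun s hs => ?_) ?_).congr_deriv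
        (by simp)
      · simp [clampAngle_of_nonpos hs]
      · simp [clampAngle_of_nonpos]
    · refine (hcos 0).hasDerivWithinAt.congr_of_eventuallyEq ?_ (by simp [clampAngle_of_nonpos])
      filter_upwards [self_mem_nhdsWithin, mem_nhdsWithin_of_mem_nhds (Iio_mem_nhds hpi)]
        with s hs hs'
      rw [clampAngle_of_mem hs (le_of_lt hs')]
  · rcases lt_trichotomy t (Real.pi / 2) with h' | h' | h'
    · rw [clampAngle_of_mem h.le h'.le]
      refine (hcos t).congr_of_eventuallyEq ?_
      filter_upwards [Ioo_mem_nhds h h'] with s hs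
      rw [clampAngle_of_mem hs.1.le hs.2.le]
    · subst h'
      rw [clampAngle_of_ge le_rfl, ← hasDerivWithinAt_univ, ← Iic_union_Ici (a := Real.pi / 2)]
      apply HasDerivWithinAt.union
      · refine (hcos _).hasDerivWithinAt.congr_of_eventuallyEq ?_ (by simp [clampAngle_of_ge])
        filter_upwards [self_mem_nhdsWithin, mem_nhdsWithin_of_mem_nhds (Ioi_mem_nhds hpi)]
          with s hs hs'
        rw [clampAngle_of_mem (le_of_lt hs') hs]
      · refine ((hasDerivWithinAt_const _ (Ici (Real.pi / 2)) (0 : ℝ)).congr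
          (fun s hs => ?_) ?_).congr_deriv (by simp)
        · simp [clampAngle_of_ge hs]
        · simp [clampAngle_of_ge]
    · rw [clampAngle_of_ge h'.le]
      refine ((hasDerivAt_const t (0 : ℝ)).congr_of_eventuallyEq ?_).congr_deriv (by simp)
      filter_upwards [Ioi_mem_nhds h'] with s hs
      simp [clampAngle_of_ge (le_of_lt hs)]

/-- The angle of the cutoff: `0` for `r ≤ d/2`, `π/2` for `r ≥ d`, linear in between. -/
def cutAngle (d r : ℝ) : ℝ := clampAngle (Real.pi / d * (r - d / 2))

/-- The squared cutoff `cos²`, equal to `1` for `r ≤ d/2` and to `0` for `r ≥ d`. -/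
def cutSq (d r : ℝ) : ℝ := Real.cos (cutAngle d r) ^ 2

theorem hasDerivAt_cutSq (d r : ℝ) :
    HasDerivAt (cutSq d)
      (-2 * (Real.pi / d) * Real.sin (cutAngle d r) * Real.cos (cutAngle d r)) r := by
  have h := (hasDerivAt_cos_sq_clampAngle (Real.pi / d * (r - d / 2))).comp r
    (((hasDerivAt_id r).sub_const (d / 2)).const_mul (Real.pi / d))
  refine (h).congr_deriv ?_
  simp [cutAngle]; ring

theorem contDiff_cutSq (d : ℝ) : ContDiff ℝ 1 (cutSq d) := by
  rw [contDiff_one_iff_deriv]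
  refine ⟨fun r => (hasDerivAt_cutSq d r).differentiableAt, ?_⟩
  have : deriv (cutSq d) = fun r =>
      -2 * (Real.pi / d) * Real.sin (cutAngle d r) * Real.cos (cutAngle d r) :=
    funext fun r => (hasDerivAt_cutSq d r).deriv
  rw [this]
  have hc : Continuous (cutAngle d) := continuous_clampAngle.comp (by fun_prop)
  fun_prop

theorem cutAngle_of_le {d r : ℝ} (hd : 0 < d) (hr : r ≤ d / 2) : cutAngle d r = 0 :=
  clampAngle_of_nonpos (mul_nonpos_of_nonneg_of_nonpos (by positivity) (by linarith))

theorem cutAngle_of_ge {d r : ℝ} (hd : 0 < d) (hr : d ≤ r) : cutAngle d r = Real.pi / 2 := by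
  apply clampAngle_of_ge
  rw [div_mul_eq_mul_div, le_div_iff₀ hd]
  nlinarith [Real.pi_pos]

theorem cutAngle_of_mem {d r : ℝ} (hd : 0 < d) (h : d / 2 ≤ r) (hr : r ≤ d) :
    cutAngle d r = Real.pi / d * (r - d / 2) := by
  have := Real.pi_pos
  apply clampAngle_of_mem
  · exact mul_nonneg (by positivity) (by linarith)
  · rw [div_mul_eq_mul_div, div_le_iff₀ hd]
    nlinarith

theorem cutSq_of_le {d r : ℝ} (hd : 0 < d) (hr : r ≤ d / 2) : cutSq d r = 1 := by
  simp [cutSq, cutAngle_of_le hd hr]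

theorem cutSq_of_ge {d r : ℝ} (hd : 0 < d) (hr : d ≤ r) : cutSq d r = 0 := by
  simp [cutSq, cutAngle_of_ge hd hr]

/-- On the annulus, the loss of `r⁻²` caused by the cutoff is at most `2 d⁻²`. -/
theorem one_sub_cutSq_div_sq_le {d r : ℝ} (hd : 0 < d) (h : d / 2 ≤ r) (hr : r ≤ d) :
    (1 - cutSq d r) * (1 / r ^ 2) ≤ 2 * (1 / d ^ 2) := by
  have hr0 : 0 < r := by linarith
  have hpi := Real.pi_pos
  have key : (1 - cutSq d r) * d ^ 2 ≤ 2 * r ^ 2 := by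
    have hs : 1 - cutSq d r = Real.sin (cutAngle d r) ^ 2 := by
      rw [cutSq, Real.cos_sq']; ring
    rw [hs]
    -- The angle is `π/4` at `r = 3d/4`. Below it, `sin² ≤ 1/2` and `r² ≥ d²/4`; above it, `sin² ≤
    -- 1` and `2r² ≥ 9d²/8`.
    rcases le_total (r) (3 / 4 * d) with h3 | h3
    · have hang : cutAngle d r ≤ Real.pi / 4 := by
        rw [cutAngle_of_mem hd h hr, div_mul_eq_mul_div, div_le_iff₀ hd]
        nlinarith
      have h0 : 0 ≤ cutAngle d r := le_max_left _ _
      have h1 : Real.sin (cutAngle d r) ≤ Real.sin (Real.pi / 4) :=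
        Real.sin_le_sin_of_le_of_le_pi_div_two (by linarith) (by linarith) hang
      have h2 : 0 ≤ Real.sin (cutAngle d r) :=
        Real.sin_nonneg_of_nonneg_of_le_pi h0 (by linarith)
      have h4 : Real.sin (cutAngle d r) ^ 2 ≤ 1 / 2 := by
        calc _ ≤ Real.sin (Real.pi / 4) ^ 2 := by gcongr
          _ = 1 / 2 := by
            rw [Real.sin_pi_div_four, div_pow, Real.sq_sqrt (by norm_num)]; norm_num
      nlinarith
    · have := Real.sin_sq_le_one (cutAngle d r)
      nlinarith
  rw [mul_one_div, mul_one_div, div_le_div_iff₀ (by positivity) (by positivity)]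
  exact key

/-- A smooth nondecreasing truncation: `0` for `r ≤ ε`, `1` for `r ≥ 2ε`. -/
def innerCut (ε r : ℝ) : ℝ := Real.smoothTransition (r / ε - 1)

theorem innerCut_nonneg (ε r : ℝ) : 0 ≤ innerCut ε r := Real.smoothTransition.nonneg _

theorem innerCut_le_one (ε r : ℝ) : innerCut ε r ≤ 1 := Real.smoothTransition.le_one _

theorem innerCut_of_le {ε r : ℝ} (hε : 0 < ε) (hr : r ≤ ε) : innerCut ε r = 0 :=
  Real.smoothTransition.zero_of_nonpos (by rw [sub_nonpos, div_le_one hε]; exact hr)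

theorem innerCut_of_ge {ε r : ℝ} (hε : 0 < ε) (hr : 2 * ε ≤ r) : innerCut ε r = 1 :=
  Real.smoothTransition.one_of_one_le (by rw [le_sub_iff_add_le, le_div_iff₀ hε]; linarith)

theorem contDiff_innerCut (ε : ℝ) : ContDiff ℝ 1 (innerCut ε) :=
  Real.smoothTransition.contDiff.comp (by fun_prop)

theorem deriv_innerCut_nonneg {ε : ℝ} (hε : 0 < ε) (r : ℝ) : 0 ≤ deriv (innerCut ε) r := by
  apply Monotone.deriv_nonneg
  intro s t hst
  apply Real.smoothTransition.monotone
  gcongr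

/-! ### The Poincaré ball and `cosh` of the distance -/

variable {N : ℕ}

theorem mem_hypSpace {x : EuclideanSpace ℝ (Fin N)} : x ∈ hypSpace N ↔ ‖x‖ < 1 := by
  simp [hypSpace]

theorem isOpen_hypSpace : IsOpen (hypSpace N) := Metric.isOpen_ball

theorem one_sub_normSq_pos {x : EuclideanSpace ℝ (Fin N)} (hx : x ∈ hypSpace N) :
    0 < 1 - ‖x‖ ^ 2 := by
  rw [mem_hypSpace] at hx
  nlinarith [norm_nonneg x]

theorem conf_pos {x : EuclideanSpace ℝ (Fin N)} (hx : x ∈ hypSpace N) : 0 < conf x :=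
  div_pos two_pos (one_sub_normSq_pos hx)

/-- The hyperbolic cosine of the geodesic distance to `z`. -/
def hypCosh (z x : EuclideanSpace ℝ (Fin N)) : ℝ :=
  1 + 2 * ‖x - z‖ ^ 2 / ((1 - ‖x‖ ^ 2) * (1 - ‖z‖ ^ 2))

/-- The Euclidean gradient of `hypCosh z`. -/
def gradCosh (z x : EuclideanSpace ℝ (Fin N)) : EuclideanSpace ℝ (Fin N) :=
  (4 / (1 - ‖z‖ ^ 2)) • ((1 - ‖x‖ ^ 2)⁻¹ • (x - z) +
    (‖x - z‖ ^ 2 * ((1 - ‖x‖ ^ 2) ^ 2)⁻¹) • x)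

theorem one_le_hypCosh {x z : EuclideanSpace ℝ (Fin N)} (hx : x ∈ hypSpace N)
    (hz : z ∈ hypSpace N) : 1 ≤ hypCosh z x := by
  have h1 := one_sub_normSq_pos hx
  have h2 := one_sub_normSq_pos hz
  have : 0 ≤ 2 * ‖x - z‖ ^ 2 / ((1 - ‖x‖ ^ 2) * (1 - ‖z‖ ^ 2)) := by positivity
  unfold hypCosh; linarith

theorem one_lt_hypCosh {x z : EuclideanSpace ℝ (Fin N)} (hx : x ∈ hypSpace N)
    (hz : z ∈ hypSpace N) (h : x ≠ z) : 1 < hypCosh z x := by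
  have h1 := one_sub_normSq_pos hx
  have h2 := one_sub_normSq_pos hz
  have h3 : 0 < ‖x - z‖ := norm_pos_iff.2 (sub_ne_zero.2 h)
  have : 0 < 2 * ‖x - z‖ ^ 2 / ((1 - ‖x‖ ^ 2) * (1 - ‖z‖ ^ 2)) := by positivity
  unfold hypCosh; linarith

theorem hypDist_eq_arcosh (x z : EuclideanSpace ℝ (Fin N)) :
    hypDist x z = Real.arcosh (hypCosh z x) := rfl

theorem cosh_hypDist {x z : EuclideanSpace ℝ (Fin N)} (hx : x ∈ hypSpace N)
    (hz : z ∈ hypSpace N) : Real.cosh (hypDist x z) = hypCosh z x :=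
  Real.cosh_arcosh (one_le_hypCosh hx hz)

theorem hypDist_nonneg {x z : EuclideanSpace ℝ (Fin N)} (hx : x ∈ hypSpace N)
    (hz : z ∈ hypSpace N) : 0 ≤ hypDist x z :=
  Real.arcosh_nonneg (one_le_hypCosh hx hz)

theorem hypDist_pos {x z : EuclideanSpace ℝ (Fin N)} (hx : x ∈ hypSpace N)
    (hz : z ∈ hypSpace N) (h : x ≠ z) : 0 < hypDist x z :=
  Real.arcosh_pos (one_lt_hypCosh hx hz h)

theorem hypDist_comm (x z : EuclideanSpace ℝ (Fin N)) : hypDist x z = hypDist z x := by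
  unfold hypDist
  rw [norm_sub_rev, mul_comm (1 - ‖x‖ ^ 2)]

theorem hasFDerivAt_normSq (x : EuclideanSpace ℝ (Fin N)) :
    HasFDerivAt (fun x : EuclideanSpace ℝ (Fin N) => ‖x‖ ^ 2) (2 • innerSL ℝ x) x :=
  (hasStrictFDerivAt_norm_sq x).hasFDerivAt

theorem hasFDerivAt_normSq_sub (x z : EuclideanSpace ℝ (Fin N)) :
    HasFDerivAt (fun x : EuclideanSpace ℝ (Fin N) => ‖x - z‖ ^ 2) (2 • innerSL ℝ (x - z)) x :=
  ((hasFDerivAt_normSq (x - z)).comp (f := fun x => x - z) x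
    ((hasFDerivAt_id x).sub_const z)).congr_fderiv (by ext; simp)

theorem hasFDerivAt_hypCosh {x z : EuclideanSpace ℝ (Fin N)} (hx : x ∈ hypSpace N)
    (hz : z ∈ hypSpace N) : HasFDerivAt (hypCosh z) (innerSL ℝ (gradCosh z x)) x := by
  have h1 := one_sub_normSq_pos hx
  have h2 := one_sub_normSq_pos hz
  have hA := ((hasFDerivAt_normSq_sub x z).const_mul 2)
  have hB := (((hasFDerivAt_normSq x).const_sub 1).mul_const (1 - ‖z‖ ^ 2))
  have hC := (hasDerivAt_inv (by positivity : (1 - ‖x‖ ^ 2) * (1 - ‖z‖ ^ 2) ≠ 0)).comp_hasFDerivAt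
    x hB
  have := ((hA.mul hC).const_add 1)
  refine this.congr_fderiv ?_
  ext v
  simp [gradCosh]
  field_simp
  ring

/-- In hyperbolic terms `|∇cosh d|² = sinh² d`, that is, `|∇d| = 1` off the pole. Working with `cosh
d` keeps everything smooth across the pole. -/
theorem gradCosh_normSq {x z : EuclideanSpace ℝ (Fin N)} (hx : x ∈ hypSpace N)
    (hz : z ∈ hypSpace N) : (conf x ^ 2)⁻¹ * ‖gradCosh z x‖ ^ 2 = hypCosh z x ^ 2 - 1 := by
  have h1 := one_sub_normSq_pos hx
  have h2 := one_sub_normSq_pos hz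
  -- This eliminates `⟨x - z, x⟩`, leaving a rational identity in `‖x - z‖²`, `1 - ‖x‖²` and `1 -
  -- ‖z‖²`.
  have hm : 1 - ‖z‖ ^ 2 = 1 - ‖x‖ ^ 2 + 2 * inner ℝ (x - z) x - ‖x - z‖ ^ 2 := by
    rw [norm_sub_sq_real, inner_sub_left, real_inner_self_eq_norm_sq, real_inner_comm]; ring
  have hn : ‖(1 - ‖x‖ ^ 2)⁻¹ • (x - z) + (‖x - z‖ ^ 2 * ((1 - ‖x‖ ^ 2) ^ 2)⁻¹) • x‖ ^ 2 =
      (1 - ‖x‖ ^ 2)⁻¹ ^ 2 * ‖x - z‖ ^ 2 + 2 * ((1 - ‖x‖ ^ 2)⁻¹ *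
      (‖x - z‖ ^ 2 * ((1 - ‖x‖ ^ 2) ^ 2)⁻¹) * inner ℝ (x - z) x) +
      (‖x - z‖ ^ 2 * ((1 - ‖x‖ ^ 2) ^ 2)⁻¹) ^ 2 * ‖x‖ ^ 2 := by
    rw [norm_add_sq_real, norm_smul, norm_smul, inner_smul_left, inner_smul_right, mul_pow,
      mul_pow, Real.norm_eq_abs, Real.norm_eq_abs, sq_abs, sq_abs]
    simp; ring
  rw [gradCosh, norm_smul, mul_pow, hn, Real.norm_eq_abs, sq_abs, hypCosh, conf]
  generalize inner ℝ (x - z) x = p at *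
  have hp : p = ((1 - ‖z‖ ^ 2) - (1 - ‖x‖ ^ 2) + ‖x - z‖ ^ 2) / 2 := by linarith
  rw [hp]
  generalize ‖x - z‖ ^ 2 = n at *
  generalize 1 - ‖z‖ ^ 2 = m at *
  rw [show ‖x‖ ^ 2 = 1 - (1 - ‖x‖ ^ 2) by ring]
  rw [show 1 - (1 - (1 - ‖x‖ ^ 2)) = 1 - ‖x‖ ^ 2 by ring]
  generalize 1 - ‖x‖ ^ 2 = s at *
  field_simp
  ring

theorem contDiffAt_hypCosh {x z : EuclideanSpace ℝ (Fin N)} (hx : x ∈ hypSpace N)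
    (hz : z ∈ hypSpace N) {n : WithTop ℕ∞} : ContDiffAt ℝ n (hypCosh z) x := by
  have h1 := one_sub_normSq_pos hx
  have h2 := one_sub_normSq_pos hz
  unfold hypCosh
  refine contDiffAt_const.add (ContDiffAt.div ?_ ?_ (by positivity))
  · exact contDiffAt_const.mul ((contDiffAt_id.sub contDiffAt_const).norm_sq ℝ)
  · exact (contDiffAt_const.sub (contDiffAt_id.norm_sq ℝ)).mul contDiffAt_const

theorem contDiffAt_conf {x : EuclideanSpace ℝ (Fin N)} (hx : x ∈ hypSpace N)
    {n : WithTop ℕ∞} : ContDiffAt ℝ n conf x := by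
  have h1 := one_sub_normSq_pos hx
  unfold conf
  exact contDiffAt_const.div (contDiffAt_const.sub (contDiffAt_id.norm_sq ℝ)) h1.ne'

theorem contDiffAt_gradCosh {x z : EuclideanSpace ℝ (Fin N)} (hx : x ∈ hypSpace N)
    {n : WithTop ℕ∞} : ContDiffAt ℝ n (gradCosh z) x := by
  have h1 := one_sub_normSq_pos hx
  unfold gradCosh
  have hs : ContDiffAt ℝ n (fun x : EuclideanSpace ℝ (Fin N) => 1 - ‖x‖ ^ 2) x :=
    contDiffAt_const.sub (contDiffAt_id.norm_sq ℝ)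
  have hd : ContDiffAt ℝ n (fun x : EuclideanSpace ℝ (Fin N) => x - z) x :=
    contDiffAt_id.sub contDiffAt_const
  exact (((hs.inv h1.ne').smul hd).add
    (((hd.norm_sq ℝ).mul ((hs.pow 2).inv (by positivity))).smul contDiffAt_id)).const_smul _

/-- A function continuous on the ball and vanishing off a compact subset of the ball. -/
theorem continuous_and_hasCompactSupport {F : Type*} [NormedAddCommGroup F]
    {v : EuclideanSpace ℝ (Fin N) → ℝ}
    {f : EuclideanSpace ℝ (Fin N) → F} (hv : HasCompactSupport v) (hvs : tsupport v ⊆ hypSpace N)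
    (hf : ContinuousOn f (hypSpace N)) (h0 : ∀ x, x ∉ tsupport v → f x = 0) :
    Continuous f ∧ HasCompactSupport f := by
  have hts : tsupport f ⊆ tsupport v :=
    closure_minimal (fun x hx => by by_contra h; exact hx (h0 x h)) (isClosed_tsupport v)
  exact ⟨hf.continuous_of_tsupport_subset isOpen_hypSpace (hts.trans hvs),
    hv.of_isClosed_subset (isClosed_tsupport f) hts⟩

/-! ### The Laplacian of `cosh d` and integration by parts -/

theorem hasFDerivAt_conf {x : EuclideanSpace ℝ (Fin N)} (hx : x ∈ hypSpace N) :
    HasFDerivAt conf (conf x ^ 2 • innerSL ℝ x) x := by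
  have h1 := one_sub_normSq_pos hx
  have := ((hasDerivAt_inv h1.ne').comp_hasFDerivAt x
    ((hasFDerivAt_normSq x).const_sub 1)).const_mul 2
  refine this.congr_fderiv ?_
  ext v
  simp [conf]
  field_simp

/-- Coordinates of `ρ^(N-2) ∇ cosh d(·, z)`, where `ρ` is the conformal factor. -/
def fluxCoord (z : EuclideanSpace ℝ (Fin N)) (i : Fin N) (x : EuclideanSpace ℝ (Fin N)) : ℝ :=
  conf x ^ N * ((x i - z i) * (1 - ‖x‖ ^ 2) + ‖x - z‖ ^ 2 * x i) * (1 - ‖z‖ ^ 2)⁻¹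

theorem fluxCoord_eq {x z : EuclideanSpace ℝ (Fin N)} (hx : x ∈ hypSpace N) (i : Fin N) :
    fluxCoord z i x = conf x ^ N * ((conf x ^ 2)⁻¹ * gradCosh z x i) := by
  have h1 := one_sub_normSq_pos hx
  simp [fluxCoord, gradCosh, conf]
  field_simp
  ring

theorem hasFDerivAt_fluxCoord {x : EuclideanSpace ℝ (Fin N)} (hx : x ∈ hypSpace N)
    (z : EuclideanSpace ℝ (Fin N)) (i : Fin N) : ∃ L : EuclideanSpace ℝ (Fin N) →L[ℝ] ℝ,
      HasFDerivAt (fluxCoord z i) L x ∧ L (EuclideanSpace.single i 1) =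
        conf x ^ N * (1 - ‖z‖ ^ 2)⁻¹ * (N * conf x * ((x i - z i) * x i * (1 - ‖x‖ ^ 2) +
          ‖x - z‖ ^ 2 * (x i * x i)) + (1 - ‖x‖ ^ 2) + ‖x - z‖ ^ 2) := by
  have h1 := one_sub_normSq_pos hx
  have hc := (hasFDerivAt_conf hx).pow N
  have hi : HasFDerivAt (fun x : EuclideanSpace ℝ (Fin N) => x i)
    (EuclideanSpace.proj i : EuclideanSpace ℝ (Fin N) →L[ℝ] ℝ) x :=
    (EuclideanSpace.proj i : EuclideanSpace ℝ (Fin N) →L[ℝ] ℝ).hasFDerivAt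
  have hs := (hasFDerivAt_normSq x).const_sub 1
  have hd := hasFDerivAt_normSq_sub x z
  have := (hc.mul (((hi.sub_const (z i)).mul hs).add (hd.mul hi))).mul_const ((1 - ‖z‖ ^ 2)⁻¹)
  refine ⟨_, this, ?_⟩
  rcases Nat.eq_zero_or_pos N with h0 | h0
  · subst h0; exact i.elim0
  obtain ⟨k, rfl⟩ : ∃ k, N = k + 1 := ⟨N - 1, by omega⟩
  simp [EuclideanSpace.inner_single_right]
  ring

/-- This is `Δ cosh d = N cosh d` in coordinates: the flux is `√(det g) g⁻¹ ∇cosh d`, whose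
Euclidean divergence is `√(det g)` times the Laplacian. -/
theorem divergence_fluxCoord {x z : EuclideanSpace ℝ (Fin N)} (hx : x ∈ hypSpace N)
    (hz : z ∈ hypSpace N) :
    ∑ i, fderiv ℝ (fluxCoord z i) x (EuclideanSpace.single i 1) =
      conf x ^ N * (N * hypCosh z x) := by
  have h1 := one_sub_normSq_pos hx
  have h2 := one_sub_normSq_pos hz
  have : ∀ i, fderiv ℝ (fluxCoord z i) x (EuclideanSpace.single i 1) =
      conf x ^ N * (1 - ‖z‖ ^ 2)⁻¹ * (N * conf x * ((x i - z i) * x i * (1 - ‖x‖ ^ 2) +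
          ‖x - z‖ ^ 2 * (x i * x i)) + (1 - ‖x‖ ^ 2) + ‖x - z‖ ^ 2) := by
    intro i
    obtain ⟨L, hL, h⟩ := hasFDerivAt_fluxCoord hx z i
    rw [hL.fderiv, h]
  simp only [this]
  have hm : 1 - ‖z‖ ^ 2 = 1 - ‖x‖ ^ 2 + 2 * inner ℝ (x - z) x - ‖x - z‖ ^ 2 := by
    rw [norm_sub_sq_real, inner_sub_left, real_inner_self_eq_norm_sq, real_inner_comm]; ring
  have hp : ∑ i, (x i - z i) * x i = inner ℝ (x - z) x := by
    simp [PiLp.inner_apply, mul_comm]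
  have hq : ∑ i, x i * x i = ‖x‖ ^ 2 := by
    rw [EuclideanSpace.norm_sq_eq]; simp [pow_two]
  rw [← Finset.mul_sum, Finset.sum_add_distrib, Finset.sum_add_distrib, ← Finset.mul_sum,
    Finset.sum_add_distrib, ← Finset.sum_mul, ← Finset.mul_sum, hp, hq]
  simp only [Finset.sum_const, Finset.card_univ, Fintype.card_fin, nsmul_eq_mul]
  rw [hypCosh]
  have hp : inner ℝ (x - z) x = ((1 - ‖z‖ ^ 2) - (1 - ‖x‖ ^ 2) + ‖x - z‖ ^ 2) / 2 := by linarith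
  rw [hp]
  have hc : conf x = 2 / (1 - ‖x‖ ^ 2) := rfl
  generalize conf x ^ N = K
  rw [hc]
  generalize ‖x - z‖ ^ 2 = n at *
  generalize 1 - ‖z‖ ^ 2 = m at *
  rw [show ‖x‖ ^ 2 = 1 - (1 - ‖x‖ ^ 2) by ring]
  rw [show 1 - (1 - (1 - ‖x‖ ^ 2)) = 1 - ‖x‖ ^ 2 by ring]
  generalize 1 - ‖x‖ ^ 2 = s at *
  field_simp
  ring

theorem contDiffAt_fluxCoord {x z : EuclideanSpace ℝ (Fin N)} (hx : x ∈ hypSpace N)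
    (i : Fin N) {n : WithTop ℕ∞} : ContDiffAt ℝ n (fluxCoord z i) x := by
  unfold fluxCoord
  have hi : ContDiffAt ℝ n (fun x : EuclideanSpace ℝ (Fin N) => x i) x :=
    (EuclideanSpace.proj i : EuclideanSpace ℝ (Fin N) →L[ℝ] ℝ).contDiff.contDiffAt
  have hs : ContDiffAt ℝ n (fun x : EuclideanSpace ℝ (Fin N) => 1 - ‖x‖ ^ 2) x :=
    contDiffAt_const.sub (contDiffAt_id.norm_sq ℝ)
  have hd : ContDiffAt ℝ n (fun x : EuclideanSpace ℝ (Fin N) => x - z) x :=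
    contDiffAt_id.sub contDiffAt_const
  exact (((contDiffAt_conf hx).pow N).mul (((hi.sub contDiffAt_const).mul hs).add
    ((hd.norm_sq ℝ).mul hi))).mul contDiffAt_const

theorem sum_apply_smul_single (w : EuclideanSpace ℝ (Fin N)) :
    ∑ i, w i • EuclideanSpace.single i (1 : ℝ) = w := by
  simpa using (EuclideanSpace.basisFun (Fin N) ℝ).sum_repr w

/-- Integration by parts against the gradient of `cosh d(·, z)`; recall `Δ cosh d = N cosh d`. -/
theorem integral_fderiv_gradCosh {v : EuclideanSpace ℝ (Fin N) → ℝ} (hv : ContDiff ℝ 1 v)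
    (hc : HasCompactSupport v) (hs : tsupport v ⊆ hypSpace N) {z : EuclideanSpace ℝ (Fin N)}
    (hz : z ∈ hypSpace N) :
    ∫ x, conf x ^ N * ((conf x ^ 2)⁻¹ * fderiv ℝ v x (gradCosh z x)) =
      - ∫ x, conf x ^ N * (N * hypCosh z x * v x) := by
  have hdv : ∀ x, x ∉ tsupport v → fderiv ℝ v x = 0 := fun x hx =>
    image_eq_zero_of_notMem_tsupport fun h => hx (tsupport_fderiv_subset ℝ h)
  have hv0 : ∀ x, x ∉ tsupport v → v x = 0 := fun x hx => image_eq_zero_of_notMem_tsupport hx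
  have hcd := hv.continuous_fderiv one_ne_zero
  have hint : ∀ {f : EuclideanSpace ℝ (Fin N) → ℝ}, ContinuousOn f (hypSpace N) →
      (∀ x, x ∉ tsupport v → f x = 0) → Integrable f := fun hf h0 =>
    let h := continuous_and_hasCompactSupport hc hs hf h0
    h.1.integrable_of_hasCompactSupport h.2
  have hfc : ∀ i, ContinuousOn (fluxCoord z i) (hypSpace N) := fun i x hx =>
    (contDiffAt_fluxCoord hx i (n := 0)).continuousAt.continuousWithinAt
  have hfd : ∀ i, ContinuousOn (fun x => fderiv ℝ (fluxCoord z i) x (EuclideanSpace.single i 1))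
      (hypSpace N) := fun i x hx =>
    (((contDiffAt_fluxCoord hx i (n := 1)).fderiv_right (m := 0) le_rfl).continuousAt.clm_apply
      continuousAt_const).continuousWithinAt
  have h1 : ∀ i, Integrable (fun x => fderiv ℝ v x (EuclideanSpace.single i 1) * fluxCoord z i x) :=
    fun i => hint ((hcd.clm_apply continuous_const).continuousOn.mul (hfc i))
      (fun x hx => by simp [hdv x hx])
  have h2 : ∀ i, Integrable
      (fun x => v x * fderiv ℝ (fluxCoord z i) x (EuclideanSpace.single i 1)) :=
    fun i => hint (hv.continuous.continuousOn.mul (hfd i)) (fun x hx => by simp [hv0 x hx])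
  have h3 : ∀ i, Integrable (fun x => v x * fluxCoord z i x) :=
    fun i => hint (hv.continuous.continuousOn.mul (hfc i)) (fun x hx => by simp [hv0 x hx])
  -- The flux need only be differentiable on the support of `v`, so its singularity on the unit
  -- sphere is harmless.
  have key : ∀ i, ∫ x, v x * fderiv ℝ (fluxCoord z i) x (EuclideanSpace.single i 1) =
      - ∫ x, fderiv ℝ v x (EuclideanSpace.single i 1) * fluxCoord z i x := fun i =>
    integral_mul_fderiv_eq_neg_fderiv_mul_of_integrable (h1 i) (h2 i) (h3 i)
      (fun x _ => (hv.differentiable one_ne_zero) x)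
      (fun x hx => (contDiffAt_fluxCoord (hs hx) i (n := 1)).differentiableAt one_ne_zero)
  have hL : ∀ x, conf x ^ N * ((conf x ^ 2)⁻¹ * fderiv ℝ v x (gradCosh z x)) =
      ∑ i, fderiv ℝ v x (EuclideanSpace.single i 1) * fluxCoord z i x := by
    intro x
    by_cases hx : x ∈ tsupport v
    · conv_lhs => rw [← sum_apply_smul_single (gradCosh z x)]
      simp only [map_sum, map_smul, fluxCoord_eq (hs hx), Finset.mul_sum, smul_eq_mul]
      exact Finset.sum_congr rfl fun i _ => by ring
    · simp [hdv x hx]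
  have hR : ∀ x, conf x ^ N * (N * hypCosh z x * v x) =
      ∑ i, v x * fderiv ℝ (fluxCoord z i) x (EuclideanSpace.single i 1) := by
    intro x
    by_cases hx : x ∈ tsupport v
    · rw [← Finset.mul_sum, divergence_fluxCoord (hs hx) hz]; ring
    · simp [hv0 x hx]
  simp only [hL, hR]
  rw [integral_finsetSum _ (fun i _ => h1 i), integral_finsetSum _ (fun i _ => h2 i),
    ← Finset.sum_neg_distrib]
  exact Finset.sum_congr rfl fun i _ => by rw [key i, neg_neg]

/-! ### The triangle inequality for the geodesic distance -/

theorem sinh_half_hypDist {x y : EuclideanSpace ℝ (Fin N)} (hx : x ∈ hypSpace N)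
    (hy : y ∈ hypSpace N) : Real.sinh (hypDist x y / 2) =
      ‖x - y‖ / √((1 - ‖x‖ ^ 2) * (1 - ‖y‖ ^ 2)) := by
  have h1 := one_sub_normSq_pos hx
  have h2 := one_sub_normSq_pos hy
  have hr := hypDist_nonneg hx hy
  have h := cosh_hypDist hx hy
  rw [show hypDist x y = 2 * (hypDist x y / 2) by ring, Real.cosh_two_mul, Real.cosh_sq] at h
  rw [← sq_eq_sq₀ (Real.sinh_nonneg_iff.2 (by linarith)) (by positivity), div_pow,
    Real.sq_sqrt (by positivity)]
  unfold hypCosh at h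
  rw [mul_div_assoc] at h
  linarith

theorem cosh_half_hypDist {x y : EuclideanSpace ℝ (Fin N)} (hx : x ∈ hypSpace N)
    (hy : y ∈ hypSpace N) : Real.cosh (hypDist x y / 2) =
      √(‖x - y‖ ^ 2 + (1 - ‖x‖ ^ 2) * (1 - ‖y‖ ^ 2)) / √((1 - ‖x‖ ^ 2) * (1 - ‖y‖ ^ 2)) := by
  have h1 := one_sub_normSq_pos hx
  have h2 := one_sub_normSq_pos hy
  rw [← sq_eq_sq₀ (Real.cosh_pos _).le (by positivity), Real.cosh_sq, sinh_half_hypDist hx hy,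
    div_pow, div_pow, Real.sq_sqrt (by positivity), Real.sq_sqrt (by positivity)]
  field_simp

/-- Ptolemy's inequality for `x, y, z` and the inverse point `y* = y/‖y‖²`, multiplied by `‖y‖`:
each square root is `‖y‖` times a distance to `y*`. For `y = 0` it is the Euclidean triangle
inequality. -/
theorem norm_sub_mul_le {x y z : EuclideanSpace ℝ (Fin N)} (hy : y ∈ hypSpace N) :
    ‖x - z‖ * (1 - ‖y‖ ^ 2) ≤
      ‖x - y‖ * √(‖y - z‖ ^ 2 + (1 - ‖y‖ ^ 2) * (1 - ‖z‖ ^ 2)) +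
      √(‖x - y‖ ^ 2 + (1 - ‖x‖ ^ 2) * (1 - ‖y‖ ^ 2)) * ‖y - z‖ := by
  have hk : ∀ w : EuclideanSpace ℝ (Fin N), y ≠ 0 →
      ‖y‖ * dist w ((‖y‖ ^ 2)⁻¹ • y) = √(‖w - y‖ ^ 2 + (1 - ‖w‖ ^ 2) * (1 - ‖y‖ ^ 2)) := by
    intro w h0
    have hy0 : ‖y‖ ≠ 0 := norm_ne_zero_iff.2 h0
    rw [eq_comm, Real.sqrt_eq_iff_eq_sq _ (by positivity), mul_pow, dist_eq_norm,
      norm_sub_sq_real, norm_sub_sq_real, norm_smul, inner_smul_right, norm_inv, norm_pow,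
      norm_norm]
    · field_simp
      ring
    · have : 0 ≤ (‖w‖ * ‖y‖ - 1) ^ 2 := sq_nonneg _
      have := real_inner_le_norm w y
      rw [norm_sub_sq_real]
      nlinarith
  rcases eq_or_ne y 0 with rfl | h0
  · simpa using norm_sub_le x z
  · have h := EuclideanGeometry.mul_dist_le_mul_dist_add_mul_dist x y z ((‖y‖ ^ 2)⁻¹ • y)
    have h1 := one_sub_normSq_pos hy
    have hyy := hk y h0
    rw [sub_self, norm_zero, zero_pow two_ne_zero, zero_add, Real.sqrt_mul_self h1.le] at hyy
    have h3 := mul_le_mul_of_nonneg_left h (norm_nonneg y)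
    rw [norm_sub_rev y z, mul_comm (1 - ‖y‖ ^ 2) (1 - ‖z‖ ^ 2), ← hk z h0, ← hk x h0,
      ← hyy, norm_sub_rev z y]
    simp only [← dist_eq_norm]
    linarith

/-- By the half-distance formulas and the addition theorem for `sinh`, the claim becomes
`norm_sub_mul_le` after clearing denominators. -/
theorem hypDist_triangle {x y z : EuclideanSpace ℝ (Fin N)} (hx : x ∈ hypSpace N)
    (hy : y ∈ hypSpace N) (hz : z ∈ hypSpace N) :
    hypDist x z ≤ hypDist x y + hypDist y z := by
  have h1 := one_sub_normSq_pos hx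
  have h2 := one_sub_normSq_pos hy
  have h3 := one_sub_normSq_pos hz
  have h : Real.sinh (hypDist x z / 2) ≤ Real.sinh (hypDist x y / 2 + hypDist y z / 2) := by
    rw [Real.sinh_add, sinh_half_hypDist hx hz, sinh_half_hypDist hx hy, sinh_half_hypDist hy hz,
      cosh_half_hypDist hx hy, cosh_half_hypDist hy hz, div_mul_div_comm, div_mul_div_comm,
      ← add_div]
    have hs : √((1 - ‖x‖ ^ 2) * (1 - ‖y‖ ^ 2)) * √((1 - ‖y‖ ^ 2) * (1 - ‖z‖ ^ 2)) =
        √((1 - ‖x‖ ^ 2) * (1 - ‖z‖ ^ 2)) * (1 - ‖y‖ ^ 2) := by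
      rw [← Real.sqrt_mul (by positivity), ← Real.sqrt_sq h2.le, ← Real.sqrt_mul (by positivity),
        Real.sqrt_sq h2.le]
      congr 1; ring
    rw [hs, div_le_div_iff₀ (by positivity) (by positivity)]
    have := mul_le_mul_of_nonneg_right (norm_sub_mul_le (x := x) (z := z) hy)
      (Real.sqrt_nonneg ((1 - ‖x‖ ^ 2) * (1 - ‖z‖ ^ 2)))
    linarith
  rw [Real.sinh_le_sinh] at h
  linarith

/-! ### Integration against the hyperbolic volume -/

theorem measurable_conf_pow (n : ℕ) :
    Measurable (fun x : EuclideanSpace ℝ (Fin N) => ENNReal.ofReal (conf x ^ n)) := by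
  unfold conf
  fun_prop

theorem integral_hypVolume {f : EuclideanSpace ℝ (Fin N) → ℝ}
    (hf : ∀ x, x ∉ hypSpace N → f x = 0) :
    ∫ x, f x ∂(hypVolume N) = ∫ x, conf x ^ N * f x := by
  rw [hypVolume, integral_withDensity_eq_integral_toReal_smul₀
    (measurable_conf_pow N).aemeasurable (by simp)]
  rw [← setIntegral_eq_integral_of_forall_compl_eq_zero (s := hypSpace N)
    (f := fun x => conf x ^ N * f x) (fun x hx => by simp [hf x hx])]
  refine setIntegral_congr_fun isOpen_hypSpace.measurableSet fun x hx => ?_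
  simp [ENNReal.toReal_ofReal (pow_nonneg (conf_pos hx).le N)]

theorem integrable_hypVolume {v f : EuclideanSpace ℝ (Fin N) → ℝ} (hv : HasCompactSupport v)
    (hvs : tsupport v ⊆ hypSpace N) (hf : ContinuousOn f (hypSpace N))
    (h0 : ∀ x, x ∉ tsupport v → f x = 0) : Integrable f (hypVolume N) := by
  rw [hypVolume, integrable_withDensity_iff_integrable_smul₀' (measurable_conf_pow N).aemeasurable
    (by simp)]
  have hc : ContinuousOn (conf : EuclideanSpace ℝ (Fin N) → ℝ) (hypSpace N) := fun x hx =>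
    (contDiffAt_conf hx (n := 0)).continuousAt.continuousWithinAt
  have h := continuous_and_hasCompactSupport (f := fun x => conf x ^ N * f x) hv hvs
    ((hc.pow N).mul hf) (fun x hx => by simp [h0 x hx])
  refine IntegrableOn.congr_fun (h.1.integrable_of_hasCompactSupport h.2).integrableOn
    (fun x hx => ?_) isOpen_hypSpace.measurableSet
  simp [ENNReal.toReal_ofReal (pow_nonneg (conf_pos hx).le N)]

theorem hypVolume_absolutelyContinuous : hypVolume N ≪ volume :=
  (withDensity_absolutelyContinuous _ _).trans Measure.restrict_le_self.absolutelyContinuous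

theorem ae_mem_hypSpace : ∀ᵐ x ∂(hypVolume N), x ∈ hypSpace N :=
  (withDensity_absolutelyContinuous _ _).ae_le (ae_restrict_mem isOpen_hypSpace.measurableSet)

theorem hypGradSq_eq (u : EuclideanSpace ℝ (Fin N) → ℝ) (x : EuclideanSpace ℝ (Fin N)) :
    hypGradSq u x = (conf x ^ 2)⁻¹ * ‖gradient u x‖ ^ 2 := by
  rcases eq_or_ne (conf x) 0 with h | h
  · simp [hypGradSq, hypMetric, h]
  · rw [hypGradSq, hypMetric, hypGrad, real_inner_self_eq_norm_sq, norm_smul, mul_pow,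
      Real.norm_eq_abs, sq_abs]
    field_simp

theorem continuous_gradient {u : EuclideanSpace ℝ (Fin N) → ℝ} (hu : ContDiff ℝ ∞ u) :
    Continuous (gradient u) :=
  (InnerProductSpace.toDual ℝ _).symm.continuous.comp (hu.continuous_fderiv (by simp))

theorem gradient_eq_zero_of_notMem_tsupport {u : EuclideanSpace ℝ (Fin N) → ℝ}
    {x : EuclideanSpace ℝ (Fin N)} (hx : x ∉ tsupport u) : gradient u x = 0 := by
  have : fderiv ℝ u x = 0 :=
    image_eq_zero_of_notMem_tsupport fun h => hx (tsupport_fderiv_subset ℝ h)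
  simp [gradient, this]

theorem integrable_hypGradSq {u : EuclideanSpace ℝ (Fin N) → ℝ} (hu : IsTestFunction u) :
    Integrable (hypGradSq u) (hypVolume N) := by
  refine integrable_hypVolume hu.2.1 hu.2.2 (fun x hx => ?_) (fun x hx => ?_)
  · refine ContinuousAt.continuousWithinAt ?_
    rw [show hypGradSq u = fun x => (conf x ^ 2)⁻¹ * ‖gradient u x‖ ^ 2 from
      funext (hypGradSq_eq u)]
    have := (contDiffAt_conf hx (n := 0)).continuousAt
    have h2 := (continuous_gradient hu.1).continuousAt (x := x)
    exact ((this.pow 2).inv₀ (pow_ne_zero 2 (conf_pos hx).ne')).mul (h2.norm.pow 2)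
  · simp [hypGradSq_eq, gradient_eq_zero_of_notMem_tsupport hx]

/-! ### The vector field inequality -/

/-- `div G - |G|²` for the hyperbolic vector field `G = ∑ bᵢ ∇ cosh d(·, zᵢ)`. -/
def fieldDensity {ι : Type*} [Fintype ι] (z : ι → EuclideanSpace ℝ (Fin N))
    (b : ι → EuclideanSpace ℝ (Fin N) → ℝ) (x : EuclideanSpace ℝ (Fin N)) : ℝ :=
  ∑ i, (N * hypCosh (z i) x * b i x + (conf x ^ 2)⁻¹ * fderiv ℝ (b i) x (gradCosh (z i) x)) -
    (conf x ^ 2)⁻¹ * ‖∑ i, b i x • gradCosh (z i) x‖ ^ 2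

section VectorField

variable {ι : Type*} [Fintype ι] {z : ι → EuclideanSpace ℝ (Fin N)}
  {b : ι → EuclideanSpace ℝ (Fin N) → ℝ} {u : EuclideanSpace ℝ (Fin N) → ℝ}

theorem integrable_sq_mul_fieldDensity (hz : ∀ i, z i ∈ hypSpace N)
    (hb : ∀ i, ∀ x ∈ hypSpace N, ContDiffAt ℝ 1 (b i) x) (hu : IsTestFunction u) :
    Integrable (fun x => u x ^ 2 * fieldDensity z b x) (hypVolume N) := by
  refine integrable_hypVolume hu.2.1 hu.2.2 (fun x hx => ContinuousAt.continuousWithinAt ?_)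
    (fun x hx => by simp [image_eq_zero_of_notMem_tsupport hx])
  have hc := (contDiffAt_conf hx (n := 0)).continuousAt
  have hci : ContinuousAt (fun x : EuclideanSpace ℝ (Fin N) => (conf x ^ 2)⁻¹) x :=
    (hc.pow 2).inv₀ (pow_ne_zero 2 (conf_pos hx).ne')
  have hW : ∀ i, ContinuousAt (gradCosh (z i)) x := fun i =>
    (contDiffAt_gradCosh hx (n := 0)).continuousAt
  refine (hu.1.continuous.continuousAt.pow 2).mul (ContinuousAt.sub ?_ (hci.mul ?_))
  · refine tendsto_finsetSum _ fun i _ => ContinuousAt.add ?_ (hci.mul ?_)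
    · exact (continuousAt_const.mul (contDiffAt_hypCosh hx (hz i) (n := 0)).continuousAt).mul
        (hb i x hx).continuousAt
    · exact ((hb i x hx).fderiv_right (m := 0) le_rfl).continuousAt.clm_apply (hW i)
  · refine ContinuousAt.pow (ContinuousAt.norm ?_) 2
    exact tendsto_finsetSum _ fun i _ => (hb i x hx).continuousAt.smul (hW i)

/-- The vector field method: `∫ (div G - |G|²) u² ≤ ∫ |∇u|²`. -/
theorem integral_sq_mul_fieldDensity_le (hz : ∀ i, z i ∈ hypSpace N)
    (hb : ∀ i, ∀ x ∈ hypSpace N, ContDiffAt ℝ 1 (b i) x) (hu : IsTestFunction u) :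
    ∫ x, u x ^ 2 * fieldDensity z b x ∂(hypVolume N) ≤ ∫ x, hypGradSq u x ∂(hypVolume N) := by
  obtain ⟨hus, huc, hut⟩ := id hu
  have hu1 : ContDiff ℝ 1 u := hus.of_le (by simp)
  set v : ι → EuclideanSpace ℝ (Fin N) → ℝ := fun i x => u x ^ 2 * b i x with hv
  have hvt : ∀ i, tsupport (v i) ⊆ tsupport u := fun i =>
    closure_minimal (fun x hx => by
      by_contra h
      exact hx (by simp [hv, image_eq_zero_of_notMem_tsupport h])) (isClosed_tsupport u)
  have hvd : ∀ i, ContDiff ℝ 1 (v i) := fun i => contDiff_iff_contDiffAt.2 fun x => by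
    by_cases hx : x ∈ tsupport (v i)
    · exact (hu1.contDiffAt.pow 2).mul (hb i x (hut (hvt i hx)))
    · exact (contDiffAt_const (c := (0 : ℝ))).congr_of_eventuallyEq
        (notMem_tsupport_iff_eventuallyEq.1 hx)
  have hvc : ∀ i, HasCompactSupport (v i) := fun i =>
    huc.of_isClosed_subset (isClosed_tsupport _) (hvt i)
  set T₁ : ι → EuclideanSpace ℝ (Fin N) → ℝ := fun i x =>
    (conf x ^ 2)⁻¹ * fderiv ℝ (v i) x (gradCosh (z i) x) with hT₁
  set T₂ : ι → EuclideanSpace ℝ (Fin N) → ℝ := fun i x => N * hypCosh (z i) x * v i x with hT₂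
  have hT₁0 : ∀ i x, x ∉ tsupport u → T₁ i x = 0 := fun i x hx => by
    have : fderiv ℝ (v i) x = 0 :=
      image_eq_zero_of_notMem_tsupport fun h => hx (hvt i (tsupport_fderiv_subset ℝ h))
    simp [hT₁, this]
  have hT₂0 : ∀ i x, x ∉ tsupport u → T₂ i x = 0 := fun i x hx => by
    simp [hT₂, hv, image_eq_zero_of_notMem_tsupport hx]
  have hT₁i : ∀ i, Integrable (T₁ i) (hypVolume N) := fun i =>
    integrable_hypVolume huc hut (fun x hx => by
      have hc := (contDiffAt_conf hx (n := 0)).continuousAt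
      exact (((hc.pow 2).inv₀ (pow_ne_zero 2 (conf_pos hx).ne')).mul
        (((hvd i).continuous_fderiv one_ne_zero).continuousAt.clm_apply
        (contDiffAt_gradCosh hx (n := 0)).continuousAt)).continuousWithinAt) (hT₁0 i)
  have hT₂i : ∀ i, Integrable (T₂ i) (hypVolume N) := fun i =>
    integrable_hypVolume huc hut (fun x hx =>
      ((continuousAt_const.mul (contDiffAt_hypCosh hx (hz i) (n := 0)).continuousAt).mul
        (hvd i).continuous.continuousAt).continuousWithinAt) (hT₂0 i)
  have hsum : ∀ i, ∫ x, (T₁ i x + T₂ i x) ∂(hypVolume N) = 0 := by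
    intro i
    rw [integral_add (hT₁i i) (hT₂i i),
      integral_hypVolume (fun x hx => hT₁0 i x fun h => hx (hut h)),
      integral_hypVolume (fun x hx => hT₂0 i x fun h => hx (hut h)),
      integral_fderiv_gradCosh (hvd i) (hvc i) ((hvt i).trans hut) (hz i)]
    exact neg_add_cancel _
  have hTi : ∀ i, Integrable (fun x => T₁ i x + T₂ i x) (hypVolume N) := fun i =>
    (hT₁i i).add (hT₂i i)
  -- The added sum is the divergence of `u² G`, which integrates to zero. Pointwise, the difference
  -- of the two sides is the hyperbolic `|∇u + uG|²`.
  have hle : ∫ x, u x ^ 2 * fieldDensity z b x ∂(hypVolume N) ≤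
      ∫ x, (hypGradSq u x + ∑ i, (T₁ i x + T₂ i x)) ∂(hypVolume N) := by
    refine integral_mono_ae (integrable_sq_mul_fieldDensity hz hb hu)
      ((integrable_hypGradSq hu).add (integrable_finsetSum _ fun i _ => hTi i)) ?_
    filter_upwards [ae_mem_hypSpace] with x hx
    have hud : HasFDerivAt u (fderiv ℝ u x) x :=
      (hu1.differentiable one_ne_zero x).hasFDerivAt
    have hfd : ∀ i, fderiv ℝ (v i) x (gradCosh (z i) x) =
        u x ^ 2 * fderiv ℝ (b i) x (gradCosh (z i) x) +
          2 * u x * (b i x * fderiv ℝ u x (gradCosh (z i) x)) := by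
      intro i
      have hbd := ((hb i x hx).differentiableAt one_ne_zero).hasFDerivAt
      have hvi : HasFDerivAt (v i) _ x := (hud.pow 2).mul hbd
      rw [hvi.fderiv]
      simp
      ring
    set A := ∑ i, b i x • gradCosh (z i) x with hA
    have hlA : ∑ i, b i x * fderiv ℝ u x (gradCosh (z i) x) = inner ℝ (gradient u x) A := by
      rw [inner_gradient_left, hA, map_sum]
      simp
    have hsq : 0 ≤ ‖gradient u x‖ ^ 2 + 2 * u x * inner ℝ (gradient u x) A +
        u x ^ 2 * ‖A‖ ^ 2 := by
      have h := norm_add_sq_real (gradient u x) (u x • A)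
      rw [inner_smul_right, norm_smul, mul_pow, Real.norm_eq_abs, sq_abs] at h
      have := sq_nonneg ‖gradient u x + u x • A‖
      linarith
    have hci : 0 ≤ (conf x ^ 2)⁻¹ := by positivity
    have hT : ∑ i, (T₁ i x + T₂ i x) = u x ^ 2 * ∑ i, (N * hypCosh (z i) x * b i x +
        (conf x ^ 2)⁻¹ * fderiv ℝ (b i) x (gradCosh (z i) x)) +
        (conf x ^ 2)⁻¹ * (2 * u x * inner ℝ (gradient u x) A) := by
      rw [← hlA, Finset.mul_sum, Finset.mul_sum, Finset.mul_sum, ← Finset.sum_add_distrib]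
      refine Finset.sum_congr rfl fun i _ => ?_
      simp only [hT₁, hT₂]
      rw [hfd]
      simp only [hv]
      ring
    change u x ^ 2 * fieldDensity z b x ≤ hypGradSq u x + ∑ i, (T₁ i x + T₂ i x)
    rw [hT, hypGradSq_eq, fieldDensity, ← hA]
    have := mul_nonneg hci hsq
    nlinarith
  refine hle.trans (le_of_eq ?_)
  rw [integral_add (integrable_hypGradSq hu) (integrable_finsetSum _ fun i _ => hTi i),
    integral_finsetSum _ fun i _ => hTi i]
  simp [hsum]

end VectorField

/-! ### The localised field and its pointwise lower bound -/

theorem sinh_hypDist_sq {x z : EuclideanSpace ℝ (Fin N)} (hx : x ∈ hypSpace N)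
    (hz : z ∈ hypSpace N) : Real.sinh (hypDist x z) ^ 2 = hypCosh z x ^ 2 - 1 := by
  rw [← cosh_hypDist hx hz, Real.cosh_sq]; ring

theorem hasFDerivAt_hypDist {x z : EuclideanSpace ℝ (Fin N)} (hx : x ∈ hypSpace N)
    (hz : z ∈ hypSpace N) (h : x ≠ z) : HasFDerivAt (fun x => hypDist x z)
      ((Real.sinh (hypDist x z))⁻¹ • innerSL ℝ (gradCosh z x)) x := by
  have h1 := one_lt_hypCosh hx hz h
  have := (Real.hasDerivAt_arcosh (mem_Ioi.2 h1)).comp_hasFDerivAt x (hasFDerivAt_hypCosh hx hz)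
  rw [← Real.sinh_arcosh h1.le] at this
  exact this

theorem hypDist_self (z : EuclideanSpace ℝ (Fin N)) : hypDist z z = 0 := by
  simp [hypDist]

theorem eventually_hypDist_lt {z : EuclideanSpace ℝ (Fin N)} (hz : z ∈ hypSpace N) {δ : ℝ}
    (hδ : 0 < δ) : ∀ᶠ x in 𝓝 z, hypDist x z < δ := by
  have hc := (contDiffAt_hypCosh hz hz (n := 0)).continuousAt
  have h1 : hypCosh z z < Real.cosh δ := by
    rw [← cosh_hypDist hz hz, hypDist_self, Real.cosh_zero]
    exact Real.one_lt_cosh.2 hδ.ne'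
  filter_upwards [hc.eventually_lt_const h1, isOpen_hypSpace.mem_nhds hz] with x hx hxb
  have h2 := one_le_hypCosh hxb hz
  rw [hypDist_eq_arcosh, ← Real.arcosh_cosh hδ.le]
  exact (Real.arcosh_lt_arcosh (by linarith) (by linarith)).2 hx

/-- The distance fails to be differentiable only at the pole, and there the profile is locally
constant. -/
theorem contDiffAt_radial {β : ℝ → ℝ} (hβ : ∀ r, 0 < r → ContDiffAt ℝ 1 β r) {δ c : ℝ}
    (hδ : 0 < δ) (hc : ∀ r ≤ δ, β r = c) {x z : EuclideanSpace ℝ (Fin N)} (hx : x ∈ hypSpace N)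
    (hz : z ∈ hypSpace N) : ContDiffAt ℝ 1 (fun x => β (hypDist x z)) x := by
  rcases eq_or_ne x z with rfl | h
  · refine (contDiffAt_const (c := c)).congr_of_eventuallyEq ?_
    filter_upwards [eventually_hypDist_lt hz hδ] with y hy
    exact hc _ hy.le
  · have hd : ContDiffAt ℝ 1 (fun x => hypDist x z) x :=
      (Real.contDiffAt_arcosh (mem_Ioi.2 (one_lt_hypCosh hx hz h))).comp x
        (contDiffAt_hypCosh hx hz)
    exact (hβ _ (hypDist_pos hx hz h)).comp x hd

/-- The radial profile of the regularised and localised Hardy field of one pole,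
as a multiple of `∇ cosh d`. -/
def poleProfile (n d ε r : ℝ) : ℝ :=
  cutSq d r * (innerCut ε r * hardyField n r) / Real.sinh r

theorem contDiffAt_poleProfile (n d ε : ℝ) {r : ℝ} (hr : 0 < r) :
    ContDiffAt ℝ 1 (poleProfile n d ε) r :=
  ((contDiff_cutSq d).contDiffAt.mul ((contDiff_innerCut ε).contDiffAt.mul
    (contDiffAt_hardyField n hr))).div Real.contDiff_sinh.contDiffAt (Real.sinh_pos_iff.2 hr).ne'

theorem poleProfile_of_le (n d : ℝ) {ε r : ℝ} (hε : 0 < ε) (hr : r ≤ ε) :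
    poleProfile n d ε r = 0 := by
  simp [poleProfile, innerCut_of_le hε hr]

theorem hasDerivAt_poleProfile (n d ε : ℝ) {r : ℝ} (hr : 0 < r) :
    HasDerivAt (poleProfile n d ε)
      ((((-2 * (Real.pi / d) * Real.sin (cutAngle d r) * Real.cos (cutAngle d r)) *
        (innerCut ε r * hardyField n r) + cutSq d r * (deriv (innerCut ε) r * hardyField n r +
        innerCut ε r * (-(n - 2) / Real.sinh r ^ 2 + (n - 2) / 2 / r ^ 2))) * Real.sinh r -
        cutSq d r * (innerCut ε r * hardyField n r) * Real.cosh r) / Real.sinh r ^ 2) r :=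
  ((hasDerivAt_cutSq d r).mul ((((contDiff_innerCut ε).differentiable one_ne_zero) r).hasDerivAt.mul
    (hasDerivAt_hardyField n hr))).div (Real.hasDerivAt_sinh r) (Real.sinh_pos_iff.2 hr).ne'

/-- Centres of the fields: the poles, and the origin for the region away from the poles. -/
def centers {M : ℕ} (y : Fin M → EuclideanSpace ℝ (Fin N)) :
    Option (Fin M) → EuclideanSpace ℝ (Fin N) :=
  fun o => o.elim 0 y

/-- The coefficients of the localised vector field. -/
def coeffs {M : ℕ} (y : Fin M → EuclideanSpace ℝ (Fin N)) (d ε : ℝ) :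
    Option (Fin M) → EuclideanSpace ℝ (Fin N) → ℝ
  | none => fun x => (1 - ∑ k, cutSq d (hypDist x (y k))) * (((N : ℝ) - 2) / (hypCosh 0 x + 1))
  | some k => fun x => poleProfile N d ε (hypDist x (y k))

theorem zero_mem_hypSpace : (0 : EuclideanSpace ℝ (Fin N)) ∈ hypSpace N := by
  simp [mem_hypSpace]

theorem centers_mem {M : ℕ} {y : Fin M → EuclideanSpace ℝ (Fin N)} (hy : ∀ k, y k ∈ hypSpace N)
    (o : Option (Fin M)) : centers y o ∈ hypSpace N := by
  cases o with
  | none => exact zero_mem_hypSpace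
  | some k => exact hy k

theorem contDiffAt_coeffs {M : ℕ} {y : Fin M → EuclideanSpace ℝ (Fin N)}
    (hy : ∀ k, y k ∈ hypSpace N) {d ε : ℝ} (hd : 0 < d) (hε : 0 < ε) (o : Option (Fin M)) :
    ∀ x ∈ hypSpace N, ContDiffAt ℝ 1 (coeffs y d ε o) x := by
  intro x hx
  cases o with
  | none =>
    have h1 := one_le_hypCosh hx zero_mem_hypSpace
    refine (contDiffAt_const.sub (ContDiffAt.sum fun k _ => ?_)).mul (contDiffAt_const.div
      ((contDiffAt_hypCosh hx zero_mem_hypSpace).add contDiffAt_const) (by linarith))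
    exact contDiffAt_radial (fun r _ => (contDiff_cutSq d).contDiffAt) (half_pos hd)
      (fun r hr => cutSq_of_le hd hr) hx (hy k)
  | some k =>
    exact contDiffAt_radial (fun r hr => contDiffAt_poleProfile N d ε hr) hε
      (fun r hr => poleProfile_of_le N d hε hr) hx (hy k)

/-- Scalar form of the localisation estimate for one pole field and the background field. -/
theorem localized_riccati_lower_bound {n C S C₀ P q q' θ θ' h h' R : ℝ} (hn : 3 ≤ n) (hS : 0 < S)
    (hC₀ : 1 ≤ C₀) (hP : P ^ 2 ≤ S ^ 2 * (C₀ ^ 2 - 1)) (hq : 0 ≤ q) (hq1 : q ≤ 1)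
    (hθ : 0 ≤ θ) (hθ1 : θ ≤ 1) (hθ' : 0 ≤ θ') (hh : 0 ≤ h)
    (hR : h' + (n - 1) * (C / S) * h - h ^ 2 = R) :
    ∃ m, q * θ * R + (1 - q) * (n - 2) + (q * (1 - q) * m ^ 2 + q' * m) ≤
      n * C * (q * (θ * h) / S) +
      ((q' * (θ * h) + q * (θ' * h + θ * h')) * S - q * (θ * h) * C) / S ^ 2 * S⁻¹ * S ^ 2 +
      (n * C₀ * ((1 - q) * ((n - 2) / (C₀ + 1))) +
        ((1 - q) * (-(n - 2) / (C₀ + 1) ^ 2) * (C₀ ^ 2 - 1) -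
          (n - 2) / (C₀ + 1) * (q' * S⁻¹ * P))) -
      ((q * (θ * h) / S) ^ 2 * S ^ 2 +
        2 * (q * (θ * h) / S) * ((1 - q) * ((n - 2) / (C₀ + 1))) * P +
        ((1 - q) * ((n - 2) / (C₀ + 1))) ^ 2 * (C₀ ^ 2 - 1)) := by
  have hC : 0 < C₀ + 1 := by linarith
  have hl : 0 ≤ n - 2 := by linarith
  -- `m` is the radial component of `H - B`, with `H` the truncated pole field, `B` the background
  -- field and `P/S` the radial component of `∇cosh d(·,0)`.
  refine ⟨θ * h - (n - 2) / (C₀ + 1) * (P / S), ?_⟩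
  -- The three discarded gains: `e1` from the inner truncation, `e2` the surplus of the background
  -- field over `n - 2`, and `e3` the nonradial part of `q(1-q)|H-B|²`.
  have e1 : 0 ≤ q * (θ * (1 - θ) * h ^ 2 + θ' * h) :=
    mul_nonneg hq (add_nonneg (mul_nonneg (mul_nonneg hθ (by linarith)) (sq_nonneg h))
      (mul_nonneg hθ' hh))
  have e2 : 0 ≤ (1 - q) * ((n - 2) * (n - 2) / (C₀ + 1)) :=
    mul_nonneg (by linarith) (by positivity)
  have e3 : 0 ≤ q * (1 - q) * ((n - 2) / (C₀ + 1)) ^ 2 * (C₀ ^ 2 - 1 - P ^ 2 / S ^ 2) := by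
    have : P ^ 2 / S ^ 2 ≤ C₀ ^ 2 - 1 := by
      rw [div_le_iff₀ (by positivity)]; linarith
    exact mul_nonneg (mul_nonneg (mul_nonneg hq (by linarith)) (sq_nonneg _)) (by linarith)
  rw [← hR, ← sub_nonneg]
  refine (add_nonneg (add_nonneg e1 e2) e3).trans_eq ?_
  field_simp
  ring

section Pointwise

variable {M : ℕ} {y : Fin M → EuclideanSpace ℝ (Fin N)} {d ε : ℝ}
  {x : EuclideanSpace ℝ (Fin N)}

theorem hasFDerivAt_coeffs_some (hx : x ∈ hypSpace N) (hy : ∀ k, y k ∈ hypSpace N)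
    (hxy : ∀ k, x ≠ y k) (k : Fin M) :
    HasFDerivAt (coeffs y d ε (some k)) (deriv (poleProfile N d ε) (hypDist x (y k)) •
      (Real.sinh (hypDist x (y k)))⁻¹ • innerSL ℝ (gradCosh (y k) x)) x := by
  have hr := hypDist_pos hx (hy k) (hxy k)
  have hd := (hasDerivAt_poleProfile N d ε hr).differentiableAt.hasDerivAt
  exact hd.comp_hasFDerivAt x (hasFDerivAt_hypDist hx (hy k) (hxy k))

theorem hasFDerivAt_coeffs_none (hx : x ∈ hypSpace N) (hy : ∀ k, y k ∈ hypSpace N)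
    (hxy : ∀ k, x ≠ y k) :
    HasFDerivAt (coeffs y d ε none)
      ((1 - ∑ k, cutSq d (hypDist x (y k))) • ((-((N : ℝ) - 2) / (hypCosh 0 x + 1) ^ 2) •
        innerSL ℝ (gradCosh 0 x)) + (((N : ℝ) - 2) / (hypCosh 0 x + 1)) •
        -∑ k, deriv (cutSq d) (hypDist x (y k)) •
          (Real.sinh (hypDist x (y k)))⁻¹ • innerSL ℝ (gradCosh (y k) x)) x := by
  have h1 := one_le_hypCosh hx zero_mem_hypSpace
  have hq : HasFDerivAt (fun x => 1 - ∑ k, cutSq d (hypDist x (y k)))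
      (-∑ k, deriv (cutSq d) (hypDist x (y k)) •
          (Real.sinh (hypDist x (y k)))⁻¹ • innerSL ℝ (gradCosh (y k) x)) x := by
    refine (HasFDerivAt.fun_sum fun k _ => ?_).const_sub 1
    have hd := (hasDerivAt_cutSq d (hypDist x (y k))).differentiableAt.hasDerivAt
    exact hd.comp_hasFDerivAt x (hasFDerivAt_hypDist hx (hy k) (hxy k))
  have hf : HasDerivAt (fun c : ℝ => ((N : ℝ) - 2) / (c + 1))
      (-((N : ℝ) - 2) / (hypCosh 0 x + 1) ^ 2) (hypCosh 0 x) := by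
    refine ((hasDerivAt_const _ ((N : ℝ) - 2)).div ((hasDerivAt_id _).add_const 1)
      (by simp; linarith)).congr_deriv ?_
    simp
  exact hq.mul (hf.comp_hasFDerivAt x (hasFDerivAt_hypCosh hx zero_mem_hypSpace))

/-- The density of the localised field where at most one cutoff is active. -/
theorem fieldDensity_coeffs_eq (hd : 0 < d) (hx : x ∈ hypSpace N) (hy : ∀ k, y k ∈ hypSpace N)
    (hxy : ∀ k, x ≠ y k) {k : Fin M} (hk : ∀ j, j ≠ k → d ≤ hypDist x (y j)) :
    fieldDensity (centers y) (coeffs y d ε) x =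
      N * hypCosh (y k) x * poleProfile N d ε (hypDist x (y k)) +
      deriv (poleProfile N d ε) (hypDist x (y k)) * (Real.sinh (hypDist x (y k)))⁻¹ *
        Real.sinh (hypDist x (y k)) ^ 2 +
      (N * hypCosh 0 x * ((1 - cutSq d (hypDist x (y k))) * (((N : ℝ) - 2) / (hypCosh 0 x + 1))) +
        ((1 - cutSq d (hypDist x (y k))) * (-((N : ℝ) - 2) / (hypCosh 0 x + 1) ^ 2) *
          (hypCosh 0 x ^ 2 - 1) - ((N : ℝ) - 2) / (hypCosh 0 x + 1) *
          (deriv (cutSq d) (hypDist x (y k)) * (Real.sinh (hypDist x (y k)))⁻¹ *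
            ((conf x ^ 2)⁻¹ * inner ℝ (gradCosh (y k) x) (gradCosh 0 x))))) -
      (poleProfile N d ε (hypDist x (y k)) ^ 2 * Real.sinh (hypDist x (y k)) ^ 2 +
        2 * poleProfile N d ε (hypDist x (y k)) *
          ((1 - cutSq d (hypDist x (y k))) * (((N : ℝ) - 2) / (hypCosh 0 x + 1))) *
          ((conf x ^ 2)⁻¹ * inner ℝ (gradCosh (y k) x) (gradCosh 0 x)) +
        ((1 - cutSq d (hypDist x (y k))) * (((N : ℝ) - 2) / (hypCosh 0 x + 1))) ^ 2 *
          (hypCosh 0 x ^ 2 - 1)) := by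
  have hq0 : ∀ j, j ≠ k → cutSq d (hypDist x (y j)) = 0 := fun j hj => cutSq_of_ge hd (hk j hj)
  have hq1 : ∀ j, j ≠ k → deriv (cutSq d) (hypDist x (y j)) = 0 := fun j hj => by
    rw [(hasDerivAt_cutSq d _).deriv, cutAngle_of_ge hd (hk j hj)]; simp
  have hp0 : ∀ j, j ≠ k → poleProfile N d ε (hypDist x (y j)) = 0 := fun j hj => by
    simp [poleProfile, hq0 j hj]
  have hp1 : ∀ j, j ≠ k → deriv (poleProfile N d ε) (hypDist x (y j)) = 0 := fun j hj => by
    rw [(hasDerivAt_poleProfile N d ε (hypDist_pos hx (hy j) (hxy j))).deriv, hq0 j hj,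
      cutAngle_of_ge hd (hk j hj)]
    simp
  have hS : ∑ j, cutSq d (hypDist x (y j)) = cutSq d (hypDist x (y k)) :=
    Finset.sum_eq_single k (fun j _ hj => hq0 j hj) (by simp)
  have hS' : ∑ j, deriv (cutSq d) (hypDist x (y j)) •
      (Real.sinh (hypDist x (y j)))⁻¹ • innerSL ℝ (gradCosh (y j) x) =
      deriv (cutSq d) (hypDist x (y k)) •
      (Real.sinh (hypDist x (y k)))⁻¹ • innerSL ℝ (gradCosh (y k) x) :=
    Finset.sum_eq_single k (fun j _ hj => by simp [hq1 j hj]) (by simp)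
  have hn := gradCosh_normSq hx (hy k)
  have hn0 := gradCosh_normSq hx zero_mem_hypSpace
  rw [← sinh_hypDist_sq hx (hy k)] at hn
  rw [fieldDensity, Fintype.sum_option, Fintype.sum_option,
    Finset.sum_eq_single k (fun j _ hj => ?_) (by simp),
    Finset.sum_eq_single k (fun j _ hj => ?_) (by simp),
    (hasFDerivAt_coeffs_none hx hy hxy).fderiv, (hasFDerivAt_coeffs_some hx hy hxy k).fderiv, hS']
  · simp only [coeffs, centers, hS, Option.elim]
    rw [norm_add_sq_real, norm_smul, norm_smul, mul_pow, mul_pow, Real.norm_eq_abs,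
      Real.norm_eq_abs, sq_abs, sq_abs, inner_smul_left, inner_smul_right,
      real_inner_comm (gradCosh (y k) x) (gradCosh 0 x), ← hn, ← hn0]
    simp only [add_apply, smul_apply,
      neg_apply, innerSL_apply_apply, real_inner_self_eq_norm_sq, smul_eq_mul,
      conj_trivial]
    ring
  · simp [coeffs, hp0 j hj]
  · rw [(hasFDerivAt_coeffs_some hx hy hxy j).fderiv]
    simp [coeffs, hp0 j hj, hp1 j hj]

/-- Bounds the share of the near pole's potential that the cutoff field no longer supplies. It costs
at most two of the `M + 1` copies of the bracket in the threshold equation. -/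
theorem one_sub_cutSq_mul_hardyPot_le {n r : ℝ} (hn : 3 ≤ n) (hd : 0 < d) (hr : d / 2 ≤ r) :
    (1 - cutSq d r) * hardyPot n r ≤
      (n - 2) ^ 2 / 4 * (2 * (1 / d ^ 2)) + (n - 2) * (n - 3) / 2 * gFun (d / 2) := by
  have hr0 : 0 < r := by linarith
  have hq : 0 ≤ cutSq d r := sq_nonneg _
  have h1 : (1 - cutSq d r) * (1 / r ^ 2) ≤ 2 * (1 / d ^ 2) := by
    rcases le_total r d with h | h
    · exact one_sub_cutSq_div_sq_le hd hr h
    · rw [cutSq_of_ge hd h, sub_zero, one_mul]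
      have : 1 / r ^ 2 ≤ 1 / d ^ 2 := by gcongr
      have : 0 ≤ 1 / d ^ 2 := by positivity
      linarith
  have h2 : (1 - cutSq d r) * gFun r ≤ gFun (d / 2) := by
    have hg := gFun_nonneg hr0
    have := antitoneOn_gFun (mem_Ioi.2 (half_pos hd)) (mem_Ioi.2 hr0) hr
    nlinarith
  have h3 : 0 ≤ (n - 2) * (n - 3) / 2 := by
    have := mul_nonneg (by linarith : 0 ≤ n - 2) (by linarith : 0 ≤ n - 3); linarith
  calc _ = (n - 2) ^ 2 / 4 * ((1 - cutSq d r) * (1 / r ^ 2)) +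
        (n - 2) * (n - 3) / 2 * ((1 - cutSq d r) * gFun r) := by unfold hardyPot; ring
    _ ≤ _ := by gcongr

/-- Pointwise bounds for the density of the localised field. -/
theorem fieldDensity_coeffs_bounds (hN : 3 ≤ N) (hM : 2 ≤ M) (hd : IsThreshold M N d)
    (hε : 0 < ε) (hεd : 2 * ε ≤ d / 2) (hx : x ∈ hypSpace N) (hy : ∀ k, y k ∈ hypSpace N)
    (hsep : ∀ j k, j ≠ k → 2 * d ≤ hypDist (y j) (y k)) (hxy : ∀ k, x ≠ y k) :
    0 ≤ fieldDensity (centers y) (coeffs y d ε) x ∧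
      ((∀ k, 2 * ε ≤ hypDist x (y k)) →
        ∑ k, hardyPot N (hypDist x (y k)) ≤ fieldDensity (centers y) (coeffs y d ε) x) := by
  obtain ⟨hd0, hthr⟩ := hd
  have hn : (3 : ℝ) ≤ N := by exact_mod_cast hN
  have hMr : (2 : ℝ) ≤ M := by exact_mod_cast hM
  -- Two poles within `d` of `x` would be less than `2d` apart. If no pole is that close, any index
  -- serves.
  obtain ⟨k, hk⟩ : ∃ k, ∀ j, j ≠ k → d ≤ hypDist x (y j) := by
    by_cases h : ∃ k, hypDist x (y k) < d
    · obtain ⟨k, hk⟩ := h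
      refine ⟨k, fun j hj => ?_⟩
      have h1 := hypDist_triangle (hy j) hx (hy k)
      rw [hypDist_comm (y j) x] at h1
      linarith [hsep j k hj]
    · push Not at h
      exact ⟨⟨0, by omega⟩, fun j _ => h j⟩
  set r := hypDist x (y k) with hr
  have hr0 : 0 < r := hypDist_pos hx (hy k) (hxy k)
  have hS := Real.sinh_pos_iff.2 hr0
  have hP : ((conf x ^ 2)⁻¹ * inner ℝ (gradCosh (y k) x) (gradCosh 0 x)) ^ 2 ≤
      Real.sinh r ^ 2 * (hypCosh 0 x ^ 2 - 1) := by
    rw [hr, sinh_hypDist_sq hx (hy k), ← gradCosh_normSq hx (hy k),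
      ← gradCosh_normSq hx zero_mem_hypSpace]
    have := real_inner_mul_inner_self_le (gradCosh (y k) x) (gradCosh 0 x)
    rw [real_inner_self_eq_norm_sq, real_inner_self_eq_norm_sq] at this
    have h2 := mul_le_mul_of_nonneg_left this (sq_nonneg (conf x ^ 2)⁻¹)
    linarith
  have hq0 : 0 ≤ cutSq d r := sq_nonneg _
  have hq1 : cutSq d r ≤ 1 := Real.cos_sq_le_one _
  obtain ⟨m, hm⟩ := localized_riccati_lower_bound (q' := deriv (cutSq d) r) hn hS
    (one_le_hypCosh hx zero_mem_hypSpace) hP hq0 hq1 (innerCut_nonneg ε r) (innerCut_le_one ε r)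
    (deriv_innerCut_nonneg hε r) (hardyField_nonneg hn hr0) (hardyField_riccati N hr0)
  have hE := fieldDensity_coeffs_eq (ε := ε) hd0 hx hy hxy hk
  rw [← hr, (hasDerivAt_poleProfile N d ε hr0).deriv, ← cosh_hypDist hx (hy k), ← hr,
    poleProfile] at hE
  rw [(hasDerivAt_cutSq d r).deriv] at hm hE
  rw [← hE] at hm
  clear hE
  set E := fieldDensity (centers y) (coeffs y d ε) x
  set U := ((N : ℝ) - 2) ^ 2 / 4 * (1 / d ^ 2) +
    ((N : ℝ) - 3) * ((N : ℝ) - 2) / 2 * gFun (d / 2) with hU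
  have hg0 := gFun_nonneg (half_pos hd0)
  have hB : 0 ≤ ((N : ℝ) - 2) * ((N : ℝ) - 3) / 2 := by
    have := mul_nonneg (by linarith : 0 ≤ (N : ℝ) - 2) (by linarith : 0 ≤ (N : ℝ) - 3); linarith
  have hU0 : 0 ≤ U := by
    have : 0 ≤ ((N : ℝ) - 2) ^ 2 / 4 * (1 / d ^ 2) := by positivity
    have := mul_nonneg hB hg0
    rw [hU]; linarith
  have hV : ∀ j, 0 ≤ hardyPot N (hypDist x (y j)) := fun j =>
    hardyPot_nonneg hn (hypDist_pos hx (hy j) (hxy j))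
  have hVU : ∀ j, j ≠ k → hardyPot N (hypDist x (y j)) ≤ U := fun j hj => by
    refine (hardyPot_le hn hd0 (hk j hj)).trans ?_
    have h := antitoneOn_gFun (mem_Ioi.2 (half_pos hd0)) (mem_Ioi.2 hd0) (by linarith : d / 2 ≤ d)
    have := mul_le_mul_of_nonneg_left h hB
    rw [hU, hardyPot]; linarith
  have hsum : ∑ j, hardyPot N (hypDist x (y j)) ≤ hardyPot N r + ((M : ℝ) - 1) * U := by
    rw [← Finset.add_sum_erase _ _ (Finset.mem_univ k)]
    have h := Finset.sum_le_card_nsmul (Finset.univ.erase k)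
      (fun j => hardyPot N (hypDist x (y j))) U (fun j hj => hVU j (Finset.ne_of_mem_erase hj))
    rw [Finset.card_erase_of_mem (Finset.mem_univ k), Finset.card_univ, Fintype.card_fin,
      nsmul_eq_mul, Nat.cast_sub (by omega), Nat.cast_one] at h
    linarith
  have hsum0 : 0 ≤ ∑ j, hardyPot N (hypDist x (y j)) := Finset.sum_nonneg fun j _ => hV j
  have hpd : 0 ≤ Real.pi ^ 2 / d ^ 2 := by positivity
  -- Inside `d/2` the background is absent and the inner truncation may act; outside, `2ε ≤ d/2`
  -- makes the inner factor equal to `1`.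
  rcases le_total r (d / 2) with hrd | hrd
  · rw [cutSq_of_le hd0 hrd, cutAngle_of_le hd0 hrd, Real.sin_zero] at hm
    have hVk := hardyPot_nonneg hn hr0
    have hmE : innerCut ε r * (hardyPot N r + ((N : ℝ) - 2)) ≤ E := by linarith
    refine ⟨le_trans (mul_nonneg (innerCut_nonneg ε r) (by linarith)) hmE, fun h => ?_⟩
    rw [innerCut_of_ge hε (h k), one_mul] at hmE
    have : ((M : ℝ) - 1) * U ≤ (N : ℝ) - 2 := by nlinarith
    linarith
  · rw [innerCut_of_ge hε (by linarith)] at hm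
    -- Completing the square: with `s = sin`, `c = cos`, the right side is `(scm - π/d)² - π²/d²`.
    have hloc : -(Real.pi ^ 2 / d ^ 2) ≤ cutSq d r * (1 - cutSq d r) * m ^ 2 +
        -2 * (Real.pi / d) * Real.sin (cutAngle d r) * Real.cos (cutAngle d r) * m := by
      have hs : 1 - cutSq d r = Real.sin (cutAngle d r) ^ 2 := by
        rw [cutSq, Real.cos_sq']; ring
      rw [hs, cutSq, ← div_pow]
      have := sq_nonneg (Real.sin (cutAngle d r) * Real.cos (cutAngle d r) * m - Real.pi / d)
      linarith
    have hVk := one_sub_cutSq_mul_hardyPot_le (n := N) hn hd0 hrd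
    -- With `q = cutSq d r`, `E ≥ q V_k + (N-2) - π²/d² = q V_k + (M+1)U ≥ V_k + (M-1)U`, by the
    -- threshold equation and `(1-q)V_k ≤ 2U`.
    have hle : ∑ j, hardyPot N (hypDist x (y j)) ≤ E := by
      have h2 : ((N : ℝ) - 2) ^ 2 / 4 * (2 * (1 / d ^ 2)) +
          ((N : ℝ) - 2) * ((N : ℝ) - 3) / 2 * gFun (d / 2) ≤ 2 * U := by
        have := mul_nonneg hB hg0
        rw [hU]; linarith
      nlinarith
    exact ⟨hsum0.trans hle, fun _ => hle⟩

end Pointwise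

/-! ### Removal of the inner truncation and conclusion -/

theorem measurable_hypDist (z : EuclideanSpace ℝ (Fin N)) :
    Measurable (fun x => hypDist x z) := by
  unfold hypDist Real.arcosh
  fun_prop

theorem measurable_gFun : Measurable gFun := by
  unfold gFun
  fun_prop

theorem measurable_hardyPot (n : ℝ) : Measurable (hardyPot n) := by
  have := measurable_gFun
  unfold hardyPot
  fun_prop

theorem ae_ne_poles {M : ℕ} (hN : 3 ≤ N) (y : Fin M → EuclideanSpace ℝ (Fin N)) :
    ∀ᵐ x ∂(hypVolume N), ∀ k, x ≠ y k := by
  have : Nonempty (Fin N) := ⟨⟨0, by omega⟩⟩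
  have h : ∀ᵐ x ∂(volume : Measure (EuclideanSpace ℝ (Fin N))), ∀ k, x ≠ y k :=
    ae_all_iff.2 fun k => compl_mem_ae_iff.2 ((finite_singleton (y k)).measure_zero volume)
  exact hypVolume_absolutelyContinuous.ae_le h

theorem integrable_sq {u : EuclideanSpace ℝ (Fin N) → ℝ} (hu : IsTestFunction u) :
    Integrable (fun x => u x ^ 2) (hypVolume N) :=
  integrable_hypVolume hu.2.1 hu.2.2 (hu.1.continuous.pow 2).continuousOn
    (fun x hx => by simp [image_eq_zero_of_notMem_tsupport hx])

section Multipolar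

variable {M : ℕ} {y : Fin M → EuclideanSpace ℝ (Fin N)} {d : ℝ}
  {u : EuclideanSpace ℝ (Fin N) → ℝ}

/-- Fatou's lemma: off the poles the truncated densities eventually dominate the potential, and
nonnegativity holds for every `ε`. Using `∫⁻` avoids presupposing that the singular integrals are
finite; finiteness is then deduced from this bound. -/
theorem lintegral_sq_mul_hardyPot_le (hN : 3 ≤ N) (hM : 2 ≤ M) (hd : IsThreshold M N d)
    (hy : ∀ k, y k ∈ hypSpace N) (hsep : ∀ j k, j ≠ k → 2 * d ≤ hypDist (y j) (y k))
    (hu : IsTestFunction u) :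
    ∫⁻ x, ENNReal.ofReal (u x ^ 2 * ∑ k, hardyPot N (hypDist x (y k))) ∂(hypVolume N) ≤
      ENNReal.ofReal (∫ x, hypGradSq u x ∂(hypVolume N)) := by
  have hd0 := hd.1
  -- The factor `d/4` keeps the inner truncation inside radius `d/2`, where the outer cutoff is
  -- still `1`.
  set ε : ℕ → ℝ := fun n => d / 4 * (1 / ((n : ℝ) + 1)) with hεdef
  have hε : ∀ n, 0 < ε n := fun n => by positivity
  have hεd : ∀ n, 2 * ε n ≤ d / 2 := fun n => by
    have : 1 / ((n : ℝ) + 1) ≤ 1 := by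
      rw [div_le_one (by positivity)]; linarith [(Nat.cast_nonneg n : (0 : ℝ) ≤ n)]
    have := mul_le_mul_of_nonneg_left this (by positivity : 0 ≤ d / 4)
    simp only [hεdef]; linarith
  have hεt : Tendsto (fun n => 2 * ε n) atTop (𝓝 0) := by
    have := (tendsto_one_div_add_atTop_nhds_zero_nat (𝕜 := ℝ)).const_mul (2 * (d / 4))
    simpa [hεdef, mul_assoc] using this
  set E : ℕ → EuclideanSpace ℝ (Fin N) → ℝ := fun n =>
    fieldDensity (centers y) (coeffs y d (ε n)) with hE
  have hint : ∀ n, Integrable (fun x => u x ^ 2 * E n x) (hypVolume N) := fun n =>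
    integrable_sq_mul_fieldDensity (centers_mem hy) (contDiffAt_coeffs hy hd0 (hε n)) hu
  have hle : ∀ n, ∫⁻ x, ENNReal.ofReal (u x ^ 2 * E n x) ∂(hypVolume N) ≤
      ENNReal.ofReal (∫ x, hypGradSq u x ∂(hypVolume N)) := by
    intro n
    rw [← ofReal_integral_eq_lintegral_ofReal (hint n)]
    · exact ENNReal.ofReal_le_ofReal (integral_sq_mul_fieldDensity_le (centers_mem hy)
        (contDiffAt_coeffs hy hd0 (hε n)) hu)
    · filter_upwards [ae_mem_hypSpace, ae_ne_poles hN y] with x hx hxy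
      exact mul_nonneg (sq_nonneg _)
        (fieldDensity_coeffs_bounds hN hM hd (hε n) (hεd n) hx hy hsep hxy).1
  calc _ ≤ ∫⁻ x, liminf (fun n => ENNReal.ofReal (u x ^ 2 * E n x)) atTop ∂(hypVolume N) := by
        refine lintegral_mono_ae ?_
        filter_upwards [ae_mem_hypSpace, ae_ne_poles hN y] with x hx hxy
        refine le_liminf_of_le (by isBoundedDefault) ?_
        have hev : ∀ᶠ n in atTop, ∀ k, 2 * ε n ≤ hypDist x (y k) := by
          rw [eventually_all]
          exact fun k => hεt.eventually_le_const (hypDist_pos hx (hy k) (hxy k))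
        filter_upwards [hev] with n hn
        exact ENNReal.ofReal_le_ofReal (mul_le_mul_of_nonneg_left
          ((fieldDensity_coeffs_bounds hN hM hd (hε n) (hεd n) hx hy hsep hxy).2 hn) (sq_nonneg _))
    _ ≤ liminf (fun n => ∫⁻ x, ENNReal.ofReal (u x ^ 2 * E n x) ∂(hypVolume N)) atTop :=
        lintegral_liminf_le' fun n => (hint n).aestronglyMeasurable.aemeasurable.ennreal_ofReal
    _ ≤ _ := liminf_le_of_le (by isBoundedDefault) fun b hb => by
        obtain ⟨n, hn⟩ := hb.exists
        exact hn.trans (hle n)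

theorem multipolar_hardy (hN : 3 ≤ N) (hM : 2 ≤ M) (hd : IsThreshold M N d)
    (hy : ∀ k, y k ∈ hypSpace N) (hsep : ∀ j k, j ≠ k → 2 * d ≤ hypDist (y j) (y k))
    (hu : IsTestFunction u) :
    (∀ k, Integrable (fun x => u x ^ 2 / hypDist x (y k) ^ 2) (hypVolume N)) ∧
    (∀ k, Integrable (fun x => gFun (hypDist x (y k)) * u x ^ 2) (hypVolume N)) ∧
    ((N : ℝ) - 2) ^ 2 / 4 * ∑ k, ∫ x, u x ^ 2 / hypDist x (y k) ^ 2 ∂(hypVolume N) +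
      ((N : ℝ) - 2) * ((N : ℝ) - 3) / 2 *
        ∑ k, ∫ x, gFun (hypDist x (y k)) * u x ^ 2 ∂(hypVolume N) ≤
      ∫ x, hypGradSq u x ∂(hypVolume N) := by
  have hn : (3 : ℝ) ≤ N := by exact_mod_cast hN
  have hum : Measurable u := hu.1.continuous.measurable
  have hrm : ∀ k, Measurable (fun x => hypDist x (y k)) := fun k => measurable_hypDist (y k)
  have hgm : ∀ k, Measurable (fun x => gFun (hypDist x (y k))) := fun k =>
    measurable_gFun.comp (hrm k)
  have hVm : Measurable (fun x => ∑ k, hardyPot N (hypDist x (y k))) :=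
    Finset.measurable_sum _ fun k _ => (measurable_hardyPot N).comp (hrm k)
  have hlin := lintegral_sq_mul_hardyPot_le hN hM hd hy hsep hu
  have hnn : 0 ≤ᵐ[hypVolume N] fun x => u x ^ 2 * ∑ k, hardyPot N (hypDist x (y k)) := by
    filter_upwards [ae_mem_hypSpace, ae_ne_poles hN y] with x hx hxy
    exact mul_nonneg (sq_nonneg _) (Finset.sum_nonneg fun k _ =>
      hardyPot_nonneg hn (hypDist_pos hx (hy k) (hxy k)))
  have hVi : Integrable (fun x => u x ^ 2 * ∑ k, hardyPot N (hypDist x (y k))) (hypVolume N) :=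
    ⟨((hum.pow_const 2).mul hVm).aestronglyMeasurable,
      (hasFiniteIntegral_iff_ofReal hnn).2 (hlin.trans_lt ENNReal.ofReal_lt_top)⟩
  have hI1 : ∀ k, Integrable (fun x => u x ^ 2 / hypDist x (y k) ^ 2) (hypVolume N) := by
    intro k
    refine (hVi.const_mul (4 / ((N : ℝ) - 2) ^ 2)).mono'
      ((hum.pow_const 2).div ((hrm k).pow_const 2)).aestronglyMeasurable ?_
    filter_upwards [ae_mem_hypSpace, ae_ne_poles hN y] with x hx hxy
    have hr : ∀ k, 0 < hypDist x (y k) := fun k => hypDist_pos hx (hy k) (hxy k)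
    have h1 : hardyPot N (hypDist x (y k)) ≤ ∑ k, hardyPot N (hypDist x (y k)) :=
      Finset.single_le_sum (f := fun k => hardyPot N (hypDist x (y k)))
        (fun j _ => hardyPot_nonneg hn (hr j)) (Finset.mem_univ k)
    have h2 : ((N : ℝ) - 2) ^ 2 / 4 * (1 / hypDist x (y k) ^ 2) ≤
        hardyPot N (hypDist x (y k)) := by
      have hB := mul_nonneg (mul_nonneg (by linarith : 0 ≤ (N : ℝ) - 2)
        (by linarith : 0 ≤ (N : ℝ) - 3)) (gFun_nonneg (hr k))
      unfold hardyPot; linarith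
    have hn2 : 0 < (N : ℝ) - 2 := by linarith
    rw [Real.norm_of_nonneg (by positivity)]
    calc u x ^ 2 / hypDist x (y k) ^ 2 = 4 / ((N : ℝ) - 2) ^ 2 *
          (u x ^ 2 * (((N : ℝ) - 2) ^ 2 / 4 * (1 / hypDist x (y k) ^ 2))) := by
          field_simp
      _ ≤ _ := by gcongr; exact h2.trans h1
  -- For `N = 3` the `g` terms drop out of the potential, so they are dominated separately, through
  -- `g(r) ≤ 1/r ≤ 1 + 1/r²`.
  have hI2 : ∀ k, Integrable (fun x => gFun (hypDist x (y k)) * u x ^ 2) (hypVolume N) := by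
    intro k
    refine ((integrable_sq hu).add (hI1 k)).mono'
      ((hgm k).mul (hum.pow_const 2)).aestronglyMeasurable ?_
    filter_upwards [ae_mem_hypSpace, ae_ne_poles hN y] with x hx hxy
    have hr := hypDist_pos hx (hy k) (hxy k)
    rw [Real.norm_of_nonneg (mul_nonneg (gFun_nonneg hr) (sq_nonneg _))]
    have h : gFun (hypDist x (y k)) ≤ 1 + (1 / hypDist x (y k)) ^ 2 := by
      nlinarith [gFun_le_inv hr, sq_nonneg (1 / hypDist x (y k) - 1), hr]
    calc gFun (hypDist x (y k)) * u x ^ 2 ≤ (1 + (1 / hypDist x (y k)) ^ 2) * u x ^ 2 := by gcongr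
      _ = u x ^ 2 + u x ^ 2 / hypDist x (y k) ^ 2 := by ring
  refine ⟨hI1, hI2, ?_⟩
  have hint : ∫ x, u x ^ 2 * ∑ k, hardyPot N (hypDist x (y k)) ∂(hypVolume N) ≤
      ∫ x, hypGradSq u x ∂(hypVolume N) := by
    have h0 : 0 ≤ ∫ x, hypGradSq u x ∂(hypVolume N) :=
      integral_nonneg fun x => by rw [hypGradSq_eq]; positivity
    rw [← ENNReal.ofReal_le_ofReal_iff h0, ofReal_integral_eq_lintegral_ofReal hVi hnn]
    exact hlin
  refine le_trans (le_of_eq ?_) hint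
  rw [← integral_finsetSum _ fun k _ => hI1 k, ← integral_finsetSum _ fun k _ => hI2 k,
    ← integral_const_mul, ← integral_const_mul, ← integral_add
      ((integrable_finsetSum _ fun k _ => hI1 k).const_mul _)
      ((integrable_finsetSum _ fun k _ => hI2 k).const_mul _)]
  refine integral_congr_ae (Eventually.of_forall fun x => ?_)
  simp only [hardyPot, Finset.mul_sum, ← Finset.sum_add_distrib]
  exact Finset.sum_congr rfl fun k _ => by ring

end Multipolar

theorem two_mul_le_hypDist_of_le_halfMinDist {M : ℕ} {y : Fin M → EuclideanSpace ℝ (Fin N)} {d : ℝ}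
    (h : d ≤ halfMinDist y) {j k : Fin M} (hjk : j ≠ k) : 2 * d ≤ hypDist (y j) (y k) := by
  have h1 : halfMinDist y ≤ hypDist (y j) (y k) / 2 :=
    ciInf_le (Set.finite_range _).bddBelow
      (⟨(j, k), hjk⟩ : {p : Fin M × Fin M // p.1 ≠ p.2})
  linarith

end MultipolarHardy

end

theorem corollary2p3 (N M : ℕ) (hN : 3 ≤ N) (hM : 2 ≤ M) :
    (∃! r : ℝ, MultipolarHardy.IsThreshold M N r) ∧
    ∀ dbar : ℝ, MultipolarHardy.IsThreshold M N dbar →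
    ∀ y : Fin M → EuclideanSpace ℝ (Fin N), (∀ k, y k ∈ MultipolarHardy.hypSpace N) →
    dbar ≤ MultipolarHardy.halfMinDist y →
    ∀ u : EuclideanSpace ℝ (Fin N) → ℝ, MultipolarHardy.IsTestFunction u →
      MeasureTheory.Integrable (fun x => MultipolarHardy.hypGradSq u x)
        (MultipolarHardy.hypVolume N) ∧
      (∀ k, MeasureTheory.Integrable (fun x => u x ^ 2 / MultipolarHardy.hypDist x (y k) ^ 2)
        (MultipolarHardy.hypVolume N)) ∧
      (∀ k, MeasureTheory.Integrable
        (fun x => MultipolarHardy.gFun (MultipolarHardy.hypDist x (y k)) * u x ^ 2)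
        (MultipolarHardy.hypVolume N)) ∧
      ∫ x, MultipolarHardy.hypGradSq u x ∂(MultipolarHardy.hypVolume N) ≥
        ((N : ℝ) - 2) ^ 2 / 4 *
            ∑ k, ∫ x, u x ^ 2 / MultipolarHardy.hypDist x (y k) ^ 2
              ∂(MultipolarHardy.hypVolume N) +
          ((N : ℝ) - 2) * ((N : ℝ) - 3) / 2 *
            ∑ k, ∫ x, MultipolarHardy.gFun (MultipolarHardy.hypDist x (y k)) * u x ^ 2
              ∂(MultipolarHardy.hypVolume N) := by
  refine ⟨MultipolarHardy.existsUnique_isThreshold N M hN, ?_⟩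
  intro d hd y hy hdy u hu
  obtain ⟨h1, h2, h3⟩ := MultipolarHardy.multipolar_hardy hN hM hd hy
    (fun j k hjk => MultipolarHardy.two_mul_le_hypDist_of_le_halfMinDist hdy hjk) hu
  exact ⟨MultipolarHardy.integrable_hypGradSq hu, h1, h2, h3⟩
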